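/- **Notions.** An NFA $A=(Q,\Sigma,E,s,F)$ has finitely many states, one start state $s$, final states $F$, and a finite set $E\subseteq Q\times\Sigma\times Q$ of transitions (no empty labels). Its size $|A|$ is the number of states plus the number of transitions, and $r$ is the number of symbols that occur on transitions of $A$. An edit string is a finite sequence of operations $(x/y)$ with $x,y\in\Sigma\cup\{\lambda\}$, not both the empty word $\lambda$; its weight is the number of its operations with $x\ne y$. The edit distance $\delta(u,v)$ is the least weight of an edit string with input part $u$ and output part $v$, and $\delta(L)=\min\{\delta(u,v): u,v\in L,\ u\neq v\}$ for a language $L$ with at least two words. For $k\ge 1$ let $T_k$ be the transducer with states $[i]$ ($0\le i\le k$) and $[i,a]$ ($1\le i\le k$, $a\in\Sigma$), start state $[0]$, all other states final, and the following edges, for all $a,\sigma,\tau\in\Sigma$: * $[i]\xrightarrow{\sigma/\sigma}[i]$ for $0\le i\le k$, and $[i,a]\xrightarrow{\sigma/\sigma}[i]$ for $1\le i\le k$, $\sigma\ne a$; * $[i]\xrightarrow{\sigma/\tau}[i+1]$ for $0\le i<k$, $\sigma\neq\tau$, and $[i,a]\xrightarrow{\sigma/\tau}[i+1]$ for $1\le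 i<k$, $\sigma\ne\tau$, $\tau\neq a$; * $[i]\xrightarrow{\lambda/\sigma}[i+1]$ for $1\le i<k$, and $[i,a]\xrightarrow{\lambda/\sigma}[i+1]$ for $1\le i<k$, $\sigma\ne a$; * $[0]\xrightarrow{a/\lambda}[1,a]$, and for $1\le i<k$ also $[i]\xrightarrow{\sigma/\lambda}[i+1]$ and $[i,a]\xrightarrow{\sigma/\lambda}[i+1,a]$. Let $A'_k$ be the product of $T_k$ with two copies of $A$: its states are triples $(\varphi,p,q)$, the start state is $([0],s,s)$, a triple is final if its three components are, and there is a transition $(\varphi,p,q)\xrightarrow{y}(\psi,p',q')$ if for some $x$ there are transitions $\varphi\xrightarrow{x/y}\psi$, $p\xrightarrow{x}p'$, $q\xrightarrow{y}q'$ in $T_k$, $A^\lambda$, $A^\lambda$, where $A^\lambda$ is $A$ with an additional loop labelled $\lambda$ at every state. **Algorithm DistBestInpAlter.** Input: an NFA $A$, given by the list of its transitions in any order, with states and used symbols numbered consecutively. Construct the accessible part of $A'_1$ and set $k\leftarrow 1$. While the current automaton $A'_k$ has no accepting path, extend it to (the accessible part of) $A'_{k+1}$, by adding the transitions that leave states with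 error counter $k$ and lead to counter $k+1$, and the transitions between states with error counter $k+1$, and set $k\leftarrow k+1$. Return $k$. In each round acceptance is tested on the states with error counter $k$ only. The algorithm is executed on a random access machine (registers and zero-initialised arrays of natural numbers) on which each constant, register or array access, addition, multiplication, comparison, logical connective, assignment and branch costs one step. **Theorem.** There is a constant $C$ such that for every NFA $A$ whose language contains at least two words, with any numbering of its states, used symbols and transitions, the algorithm DistBestInpAlter halts on input $A$ and returns $d=\delta(L(A))$; this $d$ is the least $k\ge1$ for which $A'_k$ has an accepting path; and the number of steps is at most $C\,|A|^2r^2d$. -/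

import Mathlib

namespace EditDist

/-! ### Edit strings and edit distance -/

/-- A basic edit operation `(x/y)`: `x` and `y` are symbols or empty, and not both are empty. -/
abbrev EditOp (α : Type*) := {e : Option α × Option α // e ≠ (none, none)}

/-- An operation `(x/y)` is an error if `x ≠ y`. -/
def EditOp.IsError {α : Type*} (e : EditOp α) : Prop := e.1.1 ≠ e.1.2

/-- The input part of an edit string. -/
def inp {α : Type*} (h : List (EditOp α)) : List α := (h.map fun e => e.1.1).reduceOption

/-- The output part of an edit string. -/
def out {α : Type*} (h : List (EditOp α)) : List α := (h.map fun e => e.1.2).reduceOption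

open Classical in
/-- The weight of an edit string: the number of errors in it. -/
noncomputable def weight {α : Type*} (h : List (EditOp α)) : ℕ :=
  h.countP fun e => decide e.IsError

/-- The edit (Levenshtein) distance of two words: the least weight of an edit string that
transforms `u` into `v` (such edit strings always exist). -/
noncomputable def editDist {α : Type*} (u v : List α) : ℕ :=
  sInf {w | ∃ h : List (EditOp α), inp h = u ∧ out h = v ∧ weight h = w}

/-- The edit distance of a language with at least two words: the least distance of two different
words of the language. -/
noncomputable def langDist {α : Type*} (L : Language α) : ℕ :=
  sInf {d | ∃ u ∈ L, ∃ v ∈ L, u ≠ v ∧ editDist u v = d}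

/-! ### Automata: transitions, size, alphabet -/

/-- The set of transitions `(p, a, q)`. -/
def transitions {α Q : Type*} (M : NFA α Q) : Set (Q × α × Q) := {t | t.2.2 ∈ M.step t.1 t.2.1}

/-- The alphabet used in `M`: the symbols that occur on its transitions. -/
def usedAlphabet {α Q : Type*} (M : NFA α Q) : Set α := {a | ∃ p q, (p, a, q) ∈ transitions M}

/-- The size of an automaton: the number of its states plus the number of its transitions. -/
noncomputable def size {α Q : Type*} (M : NFA α Q) : ℕ := Nat.card Q + Nat.card (transitions M)

/-! ### The input-altering transducers and their products with an automaton -/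

/-- A transducer in standard form (`none` stands for the empty word). -/
structure Transducer (α S : Type*) where
  /-- `edge φ x y ψ`: there is a transition from `φ` to `ψ` with input `x` and output `y`. -/
  edge : S → Option α → Option α → S → Prop
  start : S
  accept : Set S

/-- States `[i]` and `[i, a]`; `i` is the error counter. -/
inductive TState (α : Type*) where
  | plain (i : ℕ) : TState α
  | tagged (i : ℕ) (a : α) : TState α

/-- The error counter of a state. -/
def TState.counter {α : Type*} : TState α → ℕ
  | .plain i => i
  | .tagged i _ => i

/-- The edges of `T_k`. -/
inductive TEdge {α : Type*} (k : ℕ) : TState α → Option α → Option α → TState α → Prop where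
  | keep (i : ℕ) (σ : α) : i ≤ k → TEdge k (.plain i) (some σ) (some σ) (.plain i)
  | keepTagged (i : ℕ) (a σ : α) : 1 ≤ i → i ≤ k → a ≠ σ →
      TEdge k (.tagged i a) (some σ) (some σ) (.plain i)
  | sub (i : ℕ) (σ τ : α) : i < k → σ ≠ τ →
      TEdge k (.plain i) (some σ) (some τ) (.plain (i + 1))
  | subTagged (i : ℕ) (a σ τ : α) : 1 ≤ i → i < k → σ ≠ τ → a ≠ τ →
      TEdge k (.tagged i a) (some σ) (some τ) (.plain (i + 1))
  | ins (i : ℕ) (σ : α) : 1 ≤ i → i < k → TEdge k (.plain i) none (some σ) (.plain (i + 1))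
  | insTagged (i : ℕ) (a σ : α) : 1 ≤ i → i < k → a ≠ σ →
      TEdge k (.tagged i a) none (some σ) (.plain (i + 1))
  | delFirst (a : α) : 1 ≤ k → TEdge k (.plain 0) (some a) none (.tagged 1 a)
  | del (i : ℕ) (σ : α) : 1 ≤ i → i < k → TEdge k (.plain i) (some σ) none (.plain (i + 1))
  | delTagged (i : ℕ) (a σ : α) : 1 ≤ i → i < k →
      TEdge k (.tagged i a) (some σ) none (.tagged (i + 1) a)

/-- The transducer `T_k`: its states are those of counter at most `k`, and all of them but `[0]`
are final. (States of `TState` with a larger counter are not reachable.) -/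
def T (α : Type*) (k : ℕ) : Transducer α (TState α) where
  edge := TEdge k
  start := .plain 0
  accept := {φ | 1 ≤ φ.counter ∧ φ.counter ≤ k}

/-- The transitions of `M`, with an additional empty loop at every state. -/
def stepLoop {α Q : Type*} (M : NFA α Q) (p : Q) : Option α → Set Q
  | none => {p}
  | some a => M.step p a

/-- The product of a transducer with two copies of `M`. Its language is the set of the words of
`M` that are outputs of the transducer on words of `M`. -/
def product {α S Q : Type*} (R : Transducer α S) (M : NFA α Q) : εNFA α (S × Q × Q) where
  step := fun s y => {s' | ∃ x : Option α, R.edge s.1 x y s'.1 ∧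
    s'.2.1 ∈ stepLoop M s.2.1 x ∧ s'.2.2 ∈ stepLoop M s.2.2 y}
  start := {s | s.1 = R.start ∧ s.2.1 ∈ M.start ∧ s.2.2 ∈ M.start}
  accept := {s | s.1 ∈ R.accept ∧ s.2.1 ∈ M.accept ∧ s.2.2 ∈ M.accept}

/-- The automaton has an accepting path. -/
def HasAcceptingPath {α S : Type*} (N : εNFA α S) : Prop :=
  ∃ s ∈ N.start, ∃ f ∈ N.accept, ∃ x : List (Option α), N.IsPath s f x

/-! ### A random access machine with unit costs

Programs work on finitely many registers for natural numbers and on finitely many arrays. The only operations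
are constants, register and array access, addition, multiplication and comparison, and each of them
costs one step, as does each assignment and each branch. -/

/-- Registers, holding natural numbers. The first four hold the input, the others are for work. -/
inductive Reg where
  | nQ | nT | nS | init
  | k | lo | hi | cnt | ecnt | acc | j | c | p | q | i | i' | code
  deriving DecidableEq

/-- Arrays. The first four hold the input, the others are for work. -/
inductive Arr where
  | src | lab | dst | fin
  | first | aLab | aDst
  | idx | kind | left | right
  | eSrc | eIn | eOut | eDst
  deriving DecidableEq

/-- Arithmetic expressions. -/
inductive Expr where
  | num : ℕ → Expr
  | reg : Reg → Expr
  | get : Arr → Expr → Expr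
  | add : Expr → Expr → Expr
  | mul : Expr → Expr → Expr

/-- Tests. -/
inductive Test where
  | eq : Expr → Expr → Test
  | lt : Expr → Expr → Test
  | not : Test → Test
  | and : Test → Test → Test

/-- Commands. -/
inductive Cmd where
  | set : Reg → Expr → Cmd
  | put : Arr → Expr → Expr → Cmd
  | seq : Cmd → Cmd → Cmd
  | ite : Test → Cmd → Cmd → Cmd
  | skip : Cmd
  | loop : Test → Cmd → Cmd

/-- Contents of the registers and of the arrays. -/
structure Store where
  reg : Reg → ℕ
  arr : Arr → ℕ → ℕ

/-- Change one register. -/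
def Store.setReg (s : Store) (x : Reg) (v : ℕ) : Store :=
  ⟨Function.update s.reg x v, s.arr⟩

/-- Change one cell of one array. -/
def Store.setArr (s : Store) (a : Arr) (i v : ℕ) : Store :=
  ⟨s.reg, Function.update s.arr a (Function.update (s.arr a) i v)⟩

/-- Value of an expression. -/
def Expr.eval (s : Store) : Expr → ℕ
  | num n => n
  | reg x => s.reg x
  | get a e => s.arr a (e.eval s)
  | add e f => e.eval s + f.eval s
  | mul e f => e.eval s * f.eval s

/-- Number of steps to evaluate an expression. -/
def Expr.cost : Expr → ℕ
  | num _ => 1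
  | reg _ => 1
  | get _ e => e.cost + 1
  | add e f => e.cost + f.cost + 1
  | mul e f => e.cost + f.cost + 1

/-- Truth value of a test. -/
def Test.eval (s : Store) : Test → Bool
  | eq e f => decide (e.eval s = f.eval s)
  | lt e f => decide (e.eval s < f.eval s)
  | not b => !(b.eval s)
  | and b b' => b.eval s && b'.eval s

/-- Number of steps to evaluate a test. -/
def Test.cost : Test → ℕ
  | eq e f => e.cost + f.cost + 1
  | lt e f => e.cost + f.cost + 1
  | not b => b.cost + 1
  | and b b' => b.cost + b'.cost + 1

/-- `Run c s t s'`: started in the store `s`, the command `c` halts after exactly `t` steps in the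
store `s'`. -/
inductive Run : Cmd → Store → ℕ → Store → Prop where
  | set (x : Reg) (e : Expr) (s : Store) : Run (.set x e) s (e.cost + 1) (s.setReg x (e.eval s))
  | put (a : Arr) (e f : Expr) (s : Store) :
      Run (.put a e f) s (e.cost + f.cost + 1) (s.setArr a (e.eval s) (f.eval s))
  | skip (s : Store) : Run .skip s 1 s
  | seq {c d : Cmd} {s s' s'' : Store} {t t' : ℕ} :
      Run c s t s' → Run d s' t' s'' → Run (.seq c d) s (t + t') s''
  | iteTrue {b : Test} {c d : Cmd} {s s' : Store} {t : ℕ} :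
      b.eval s = true → Run c s t s' → Run (.ite b c d) s (b.cost + 1 + t) s'
  | iteFalse {b : Test} {c d : Cmd} {s s' : Store} {t : ℕ} :
      b.eval s = false → Run d s t s' → Run (.ite b c d) s (b.cost + 1 + t) s'
  | loopFalse {b : Test} {c : Cmd} {s : Store} :
      b.eval s = false → Run (.loop b c) s (b.cost + 1) s
  | loopTrue {b : Test} {c : Cmd} {s s' s'' : Store} {t t' : ℕ} :
      b.eval s = true → Run c s t s' → Run (.loop b c) s' t' s'' →
      Run (.loop b c) s (b.cost + 1 + t + t') s''

/-- Execution is deterministic: the result and the number of steps are determined by the program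
and the initial store. -/
theorem Run.unique {c : Cmd} {s s₁ s₂ : Store} {t₁ t₂ : ℕ} (h₁ : Run c s t₁ s₁)
    (h₂ : Run c s t₂ s₂) : t₁ = t₂ ∧ s₁ = s₂ := by
  induction h₁ generalizing t₂ s₂ with
  | set | put | skip => cases h₂; exact ⟨rfl, rfl⟩
  | seq _ _ ih ih' =>
    cases h₂ with
    | seq g g' =>
      obtain ⟨rfl, rfl⟩ := ih g
      obtain ⟨rfl, rfl⟩ := ih' g'
      exact ⟨rfl, rfl⟩
  | iteTrue hb _ ih =>
    cases h₂ with
    | iteTrue _ g => obtain ⟨rfl, rfl⟩ := ih g; exact ⟨rfl, rfl⟩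
    | iteFalse hb' _ => simp [hb] at hb'
  | iteFalse hb _ ih =>
    cases h₂ with
    | iteTrue hb' _ => simp [hb] at hb'
    | iteFalse _ g => obtain ⟨rfl, rfl⟩ := ih g; exact ⟨rfl, rfl⟩
  | loopFalse hb =>
    cases h₂ with
    | loopFalse _ => exact ⟨rfl, rfl⟩
    | loopTrue hb' _ _ => simp [hb] at hb'
  | loopTrue hb _ _ ih ih' =>
    cases h₂ with
    | loopFalse hb' => simp [hb] at hb'
    | loopTrue _ g g' =>
      obtain ⟨rfl, rfl⟩ := ih g
      obtain ⟨rfl, rfl⟩ := ih' g'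
      exact ⟨rfl, rfl⟩

instance : Coe Reg Expr := ⟨Expr.reg⟩
instance : Add Expr := ⟨Expr.add⟩
instance : Mul Expr := ⟨Expr.mul⟩
instance (n : ℕ) : OfNat Expr n := ⟨Expr.num n⟩

infixr:60 " ;; " => Cmd.seq
infix:62 " ≔ " => Cmd.set

/-! ### The algorithm

States, symbols and transitions of the input automaton are numbered from `0`. The product automaton
is stored in tables. Its states are numbered `1, …, cnt` in the order in which they are found. The
state with number `j` is `(φ, p, q)` with `p = left[j]`, `q = right[j]` and `φ = [i]` if
`kind[j] = 0`, `φ = [i, a]` if `kind[j] = a + 1`, where the error counter `i` equals `k` for the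
states with numbers greater than `lo`. The table `idx` gives the number of a state that has been
found, and `0` otherwise. The product transitions are numbered `0, …, ecnt - 1`; the tables `eIn`,
`eOut` hold `a + 1` for a symbol `a`, and `0` for the empty word. -/

/-- Group the transitions of the input automaton by their source: those with source `p` are
afterwards `(p, aLab[i], aDst[i])` with `first[p] ≤ i < first[p + 1]`. -/
def prepare : Cmd :=
  .p ≔ 0 ;; .i' ≔ 0 ;;
  .loop (.lt Reg.p Reg.nQ) (
    .put .first Reg.p Reg.i' ;;
    .i ≔ 0 ;;
    .loop (.lt Reg.i Reg.nT) (
      .ite (.eq (.get .src Reg.i) Reg.p) (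
        .put .aLab Reg.i' (.get .lab Reg.i) ;;
        .put .aDst Reg.i' (.get .dst Reg.i) ;;
        .i' ≔ Reg.i' + 1) .skip ;;
      .i ≔ Reg.i + 1) ;;
    .p ≔ Reg.p + 1) ;;
  .put .first Reg.p Reg.i'

/-- Add the product state with counter `lv`, kind `c`, components `p` and `q`, unless it is
there. In any case, `code` is its position in the table `idx` afterwards. -/
def addState (lv c p q : Expr) : Cmd :=
  .code ≔ ((lv * (Reg.nS + 1) + c) * Reg.nQ + p) * Reg.nQ + q ;;
  .ite (.eq (.get .idx Reg.code) 0) (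
    .cnt ≔ Reg.cnt + 1 ;;
    .put .kind Reg.cnt c ;;
    .put .left Reg.cnt p ;;
    .put .right Reg.cnt q ;;
    .put .idx Reg.code Reg.cnt) .skip

/-- Add the transition with label `x/y` from the product state number `j` to the given state. -/
def addTrans (x y lv c p q : Expr) : Cmd :=
  addState lv c p q ;;
  .put .eSrc Reg.ecnt Reg.j ;;
  .put .eIn Reg.ecnt x ;;
  .put .eOut Reg.ecnt y ;;
  .put .eDst Reg.ecnt (.get .idx Reg.code) ;;
  .ecnt ≔ Reg.ecnt + 1

/-- Fetch the product state number `j`. -/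
def fetch : Cmd :=
  .c ≔ .get .kind Reg.j ;; .p ≔ .get .left Reg.j ;; .q ≔ .get .right Reg.j

/-- For each transition `(v, aLab[x], aDst[x])` of the input automaton out of `v`. -/
def forOut (x v : Reg) (body : Cmd) : Cmd :=
  x ≔ .get .first v ;;
  .loop (.lt x (.get .first ((v : Expr) + 1))) (body ;; x ≔ (x : Expr) + 1)

/-- Add the transitions without error between the states of counter `k`, and all states of
counter `k` that are reached through them. -/
def close : Cmd :=
  .j ≔ Reg.lo ;;
  .loop (.lt Reg.j Reg.cnt) (
    .j ≔ Reg.j + 1 ;;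
    fetch ;;
    forOut .i .p (forOut .i' .q (
      .ite (.and (.eq (.get .aLab Reg.i) (.get .aLab Reg.i'))
          (.not (.eq (.get .aLab Reg.i' + 1) Reg.c)))
        (addTrans (.get .aLab Reg.i + 1) (.get .aLab Reg.i' + 1)
          Reg.k 0 (.get .aDst Reg.i) (.get .aDst Reg.i'))
        .skip)))

/-- Extend the product of `T_k` to the product of `T_{k+1}`, and increase `k`: for each state of
counter `k`, add the outgoing substitutions, insertions and deletions, which lead to counter
`k + 1`; then complete the states of counter `k + 1`. (From `[0]` there are no insertions, and the
deletion of `a` leads to `[1, a]`.) -/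
def extend : Cmd :=
  .hi ≔ Reg.cnt ;;
  .j ≔ Reg.lo ;;
  .loop (.lt Reg.j Reg.hi) (
    .j ≔ Reg.j + 1 ;;
    fetch ;;
    forOut .i .p (forOut .i' .q (
      .ite (.and (.not (.eq (.get .aLab Reg.i) (.get .aLab Reg.i')))
          (.not (.eq (.get .aLab Reg.i' + 1) Reg.c)))
        (addTrans (.get .aLab Reg.i + 1) (.get .aLab Reg.i' + 1)
          (Reg.k + 1) 0 (.get .aDst Reg.i) (.get .aDst Reg.i'))
        .skip)) ;;
    .ite (.eq Reg.k 0)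
      (forOut .i .p
        (addTrans (.get .aLab Reg.i + 1) 0
          (Reg.k + 1) (.get .aLab Reg.i + 1) (.get .aDst Reg.i) Reg.q))
      (forOut .i' .q
        (.ite (.not (.eq (.get .aLab Reg.i' + 1) Reg.c))
          (addTrans 0 (.get .aLab Reg.i' + 1) (Reg.k + 1) 0 Reg.p (.get .aDst Reg.i'))
          .skip) ;;
      forOut .i .p
        (addTrans (.get .aLab Reg.i + 1) 0
          (Reg.k + 1) Reg.c (.get .aDst Reg.i) Reg.q))) ;;
  .lo ≔ Reg.hi ;;
  .k ≔ Reg.k + 1 ;;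
  close

/-- Set `acc` to `1` if the product automaton has an accepting path, and to `0` otherwise. All
states in the tables are reachable, and only states of counter `k` count as final. -/
def testAccept : Cmd :=
  .acc ≔ 0 ;;
  .j ≔ Reg.lo ;;
  .loop (.lt Reg.j Reg.cnt) (
    .j ≔ Reg.j + 1 ;;
    .ite (.and (.eq (.get .fin (.get .left Reg.j)) 1) (.eq (.get .fin (.get .right Reg.j)) 1))
      (.acc ≔ 1) .skip)

/-- The algorithm. Its result is the final content of the register `k`. The product of `T_1` is
built by a first extension of the product states of counter `0`. -/
def distBestInpAlter : Cmd :=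
  prepare ;;
  .k ≔ 0 ;; .lo ≔ 0 ;; .cnt ≔ 0 ;; .ecnt ≔ 0 ;;
  addState Reg.k 0 Reg.init Reg.init ;;
  close ;;
  extend ;;
  testAccept ;;
  .loop (.eq Reg.acc 0) (extend ;; testAccept)

open Classical in
/-- The initial store for the input `M` with start state `s₀`, for the given numberings of the
states, the transitions and the used symbols: the numbers of states, of transitions and of symbols,
the start state, the sources, labels and targets of the transitions, and the indicator of the
accepting states. Everything else is `0`. -/
noncomputable def load {α Q : Type*} (M : NFA α Q) (s₀ : Q) {n m r : ℕ} (eQ : Q ≃ Fin n)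
    (eT : transitions M ≃ Fin m) (eA : usedAlphabet M ≃ Fin r) : Store where
  reg
    | .nQ => n
    | .nT => m
    | .nS => r
    | .init => eQ s₀
    | _ => 0
  arr
    | .src => fun i => if h : i < m then eQ (eT.symm ⟨i, h⟩).1.1 else 0
    | .lab => fun i => if h : i < m then
        eA ⟨(eT.symm ⟨i, h⟩).1.2.1, _, _, (eT.symm ⟨i, h⟩).2⟩ else 0
    | .dst => fun i => if h : i < m then eQ (eT.symm ⟨i, h⟩).1.2.2 else 0
    | .fin => fun i => if h : i < n then (if eQ.symm ⟨i, h⟩ ∈ M.accept then 1 else 0) else 0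
    | _ => fun _ => 0

end EditDist

namespace EditDist

/-! ### Edit strings as an inductive relation on words -/

/-! Correctness. The transducer `T_k` realises edit strings of weight at most `k` in a normal form
that forces input and output to differ. Before the first error both words agree. A first
substitution separates them for good. A first deletion of `a` makes the output a proper prefix of
the input, continued there by `a`; the tag `a` is remembered until the next output symbol, which
must differ from `a`. So every accessible state of positive counter comes with two different words
(`Separated`, `Reach.exists_words`).

Conversely, let an edit string lead from `u` to `v ≠ u`. Cancelling a common first letter does not
raise the weight (`Ed.tail`), so the common prefix can be removed. Then the first letters differ or
one word is empty, the first operation is an error, and no later step is blocked by a tag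
(`Ed.reach`). A first insertion has no edge at `[0]`, but becomes a deletion when the two words are
exchanged, which the product allows since both components are copies of the same automaton
(`Ed.reach_zero`). Hence `A'_k` accepts iff two different words have distance at most `k`, and the
least such `k` is the distance of the language.

Running time. Call the states of counter `k` level `k`. Processing a state with components `p`, `q`
takes at most a constant times `deg p * deg q` steps, where `deg` is the out-degree plus one, so
that `deg` sums to the size of the automaton. A level has at most one state for each of the `r + 1`
kinds and each pair `p`, `q`, so it costs a constant times `(r + 1) * (∑ deg) ^ 2`
(`Graph.sum_le_levelSize`). Only levels `0` to `d` are built, and `d ≥ 1`.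

The program. Level `k + 1` is the closure under error-free transitions of the error successors of
level `k` (`Graph.Reaches.mem_of_closed`); `extend` computes these in one pass and closes them by a
worklist, which ends because a level is finite. `Wp` gives total correctness together with step
counts. Since `Reach` allows arbitrary kinds, it describes both the given automaton and its numbered
copy, and `Reach.rename` and `Reach.of_rename` pass between them. -/

/-- `Ed u v w`: some edit string of weight `w` transforms `u` into `v`. -/
inductive Ed {α : Type*} : List α → List α → ℕ → Prop
  | nil : Ed [] [] 0
  | keep {u v w} (a : α) : Ed u v w → Ed (a :: u) (a :: v) w
  | sub {u v w} (a b : α) : a ≠ b → Ed u v w → Ed (a :: u) (b :: v) (w + 1)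
  | ins {u v w} (b : α) : Ed u v w → Ed u (b :: v) (w + 1)
  | del {u v w} (a : α) : Ed u v w → Ed (a :: u) v (w + 1)

section Words

variable {α : Type*}

theorem inp_append_singleton (h : List (EditOp α)) (e : EditOp α) :
    inp (h ++ [e]) = inp h ++ e.1.1.toList := by
  rcases e with ⟨⟨_ | _, _⟩, _⟩ <;> simp [inp, List.reduceOption_append]

theorem out_append_singleton (h : List (EditOp α)) (e : EditOp α) :
    out (h ++ [e]) = out h ++ e.1.2.toList := by
  rcases e with ⟨⟨_, _ | _⟩, _⟩ <;> simp [out, List.reduceOption_append]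

open Classical in
theorem weight_append_singleton (h : List (EditOp α)) (e : EditOp α) :
    weight (h ++ [e]) = weight h + if e.1.1 = e.1.2 then 0 else 1 := by
  by_cases he : e.1.1 = e.1.2 <;> simp [weight, EditOp.IsError, he]

theorem ed_of_editString (h : List (EditOp α)) : Ed (inp h) (out h) (weight h) := by
  classical
  induction h with
  | nil => exact .nil
  | cons e h ih =>
    rcases e with ⟨⟨_ | a, _ | b⟩, he⟩
    · exact absurd rfl he
    · simpa [inp, out, weight, EditOp.IsError] using Ed.ins b ih
    · simpa [inp, out, weight, EditOp.IsError] using Ed.del a ih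
    · by_cases hab : a = b
      · subst hab
        simpa [inp, out, weight, EditOp.IsError] using Ed.keep a ih
      · simpa [inp, out, weight, EditOp.IsError, hab] using Ed.sub a b hab ih

theorem exists_editString (u v : List α) :
    ∃ h : List (EditOp α), inp h = u ∧ out h = v := by
  induction u with
  | nil =>
    induction v with
    | nil => exact ⟨[], rfl, rfl⟩
    | cons b v ih =>
      obtain ⟨h, h₁, h₂⟩ := ih
      exact ⟨⟨(none, some b), by simp⟩ :: h, by simpa [inp] using h₁, by simpa [out] using h₂⟩
  | cons a u ih =>
    obtain ⟨h, h₁, h₂⟩ := ih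
    exact ⟨⟨(some a, none), by simp⟩ :: h, by simpa [inp] using h₁, by simpa [out] using h₂⟩

/-- The infimum is attained: weights are natural numbers, and every pair of words has an edit
string. -/
theorem ed_editDist (u v : List α) : Ed u v (editDist u v) := by
  obtain ⟨h, rfl, rfl⟩ := exists_editString u v
  obtain ⟨h', h₁, h₂, h₃⟩ := Nat.sInf_mem
    (s := {w | ∃ h' : List (EditOp α), inp h' = inp h ∧ out h' = out h ∧ weight h' = w})
    ⟨_, h, rfl, rfl, rfl⟩
  rw [editDist, ← h₁, ← h₂]
  simp only [h₁, h₂]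
  rw [← h₃, ← h₁, ← h₂]
  exact ed_of_editString h'

theorem editDist_le_weight (h : List (EditOp α)) : editDist (inp h) (out h) ≤ weight h :=
  Nat.sInf_le ⟨h, rfl, rfl, rfl⟩

theorem Ed.symm {u v : List α} {w : ℕ} (h : Ed u v w) : Ed v u w := by
  induction h with
  | nil => exact .nil
  | keep a _ ih => exact .keep a ih
  | sub a b hab _ ih => exact .sub b a hab.symm ih
  | ins b _ ih => exact .del b ih
  | del a _ ih => exact .ins a ih

/-- The operation that writes `b` loses its output: a kept or substituted symbol is deleted instead,
an insertion disappears. Only a kept symbol costs one more. -/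
theorem Ed.drop_output {u v : List α} {b : α} {w : ℕ} (h : Ed u (b :: v) w) :
    ∃ w' ≤ w + 1, Ed u v w' := by
  generalize hx : b :: v = x at h
  induction h with
  | nil => cases hx
  | keep a h =>
    cases hx
    exact ⟨_, le_rfl, .del _ h⟩
  | sub a c hac h =>
    cases hx
    exact ⟨_, by omega, .del _ h⟩
  | ins c h =>
    cases hx
    exact ⟨_, by omega, h⟩
  | del a h ih =>
    obtain ⟨w', hw, h'⟩ := ih hx
    exact ⟨w' + 1, by omega, .del a h'⟩

/-- If the two letters are not matched, the first operation is an error, and its weight pays for the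
one that `Ed.drop_output` may add. -/
theorem Ed.tail {u v : List α} {a : α} {w : ℕ} (h : Ed (a :: u) (a :: v) w) :
    ∃ w' ≤ w, Ed u v w' := by
  cases h with
  | keep _ h => exact ⟨w, le_rfl, h⟩
  | sub _ _ hab _ => exact absurd rfl hab
  | ins _ h =>
    obtain ⟨w', hw, h'⟩ := h.symm.drop_output
    exact ⟨w', hw, h'.symm⟩
  | del _ h => exact h.drop_output

end Words

/-! ### Reachable states of the products -/

/-- `Reach tr s o tag k c p q`: the state with counter `k`, kind `c` and components `p`, `q` of the
product of the union of the transducers with two copies of the automaton with transitions `tr` and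
start state `s` is accessible. The kind of `[k]` is `o`, the kind of `[k, a]` is `tag a`. -/
inductive Reach {α Q γ : Type*} (tr : Q → α → Q → Prop) (s : Q) (o : γ) (tag : α → γ) :
    ℕ → γ → Q → Q → Prop
  | start : Reach tr s o tag 0 o s s
  | keep {k c p q a p' q'} : Reach tr s o tag k c p q → tr p a p' → tr q a q' → tag a ≠ c →
      Reach tr s o tag k o p' q'
  | sub {k c p q a b p' q'} : Reach tr s o tag k c p q → tr p a p' → tr q b q' → a ≠ b →
      tag b ≠ c → Reach tr s o tag (k + 1) o p' q'
  | ins {k c p q b q'} : Reach tr s o tag k c p q → k ≠ 0 → tr q b q' → tag b ≠ c →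
      Reach tr s o tag (k + 1) o p q'
  | delFirst {c p q a p'} : Reach tr s o tag 0 c p q → tr p a p' →
      Reach tr s o tag 1 (tag a) p' q
  | del {k c p q a p'} : Reach tr s o tag k c p q → k ≠ 0 → tr p a p' →
      Reach tr s o tag (k + 1) c p' q

section Automaton

variable {α Q : Type*} {M : NFA α Q} {s₀ : Q}

/-- Accessible states of the products of the transducers with `M`. -/
abbrev StateReach (M : NFA α Q) (s₀ : Q) : ℕ → Option α → Q → Q → Prop :=
  Reach (fun p a q => q ∈ M.step p a) s₀ none some

/-- An accessible state with error counter between `1` and `k` whose last components are final. -/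
def AcceptsWithin (M : NFA α Q) (s₀ : Q) (k : ℕ) : Prop :=
  ∃ i c p q, 1 ≤ i ∧ i ≤ k ∧ StateReach M s₀ i c p q ∧ p ∈ M.accept ∧ q ∈ M.accept

/-- Tags arise only from deletions, which read a symbol of a transition. The counter bound supplies
the conditions `1 ≤ i` of tagged edges; the membership allows numberings that are injective on used
symbols only. -/
theorem Reach.tag_spec {i : ℕ} {c : Option α} {p q : Q} (h : StateReach M s₀ i c p q) :
    ∀ a, c = some a → 1 ≤ i ∧ a ∈ usedAlphabet M := by
  induction h with
  | start | keep | sub | ins => intro a h; cases h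
  | delFirst h h₁ => rintro a ⟨⟩; exact ⟨le_rfl, _, _, h₁⟩
  | del h _ _ ih => intro a hc; exact ⟨by omega, (ih a hc).2⟩

theorem Reach.zero_spec {i : ℕ} {c : Option α} {p q : Q} (h : StateReach M s₀ i c p q)
    (hi : i = 0) : c = none := by
  rcases c with _ | a
  · rfl
  · have := (h.tag_spec a rfl).1
    omega

/-! ### Paths of the products and accessible states -/

/-- The kind of a transducer state. -/
def TState.tag : TState α → Option α
  | .plain _ => none
  | .tagged _ a => some a

/-- The transducer state with given counter and kind. -/
def TState.ofTag (i : ℕ) : Option α → TState α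
  | none => .plain i
  | some a => .tagged i a

theorem TEdge.reach {k : ℕ} {φ ψ : TState α} {x y : Option α} {p q p' q' : Q}
    (h : TEdge k φ x y ψ) (hr : StateReach M s₀ φ.counter φ.tag p q)
    (hp : p' ∈ stepLoop M p x) (hq : q' ∈ stepLoop M q y) :
    StateReach M s₀ ψ.counter ψ.tag p' q' ∧ ψ.counter ≤ k := by
  cases h with
  | keep i σ hi => exact ⟨.keep hr hp hq (by simp [TState.tag]), hi⟩
  | keepTagged i a σ h1 hi ha => exact ⟨.keep hr hp hq (by simpa [TState.tag] using ha.symm), hi⟩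
  | sub i σ τ hi hne => exact ⟨.sub hr hp hq hne (by simp [TState.tag]), hi⟩
  | subTagged i a σ τ h1 hi hne ha =>
    exact ⟨.sub hr hp hq hne (by simpa [TState.tag] using ha.symm), hi⟩
  | ins i σ h1 hi =>
    cases hp
    exact ⟨.ins hr (Nat.ne_of_gt h1) hq (by simp [TState.tag]), hi⟩
  | insTagged i a σ h1 hi ha =>
    cases hp
    exact ⟨.ins hr (Nat.ne_of_gt h1) hq (by simpa [TState.tag] using ha.symm), hi⟩
  | delFirst a hk =>
    cases hq
    exact ⟨.delFirst hr hp, hk⟩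
  | del i σ h1 hi =>
    cases hq
    exact ⟨.del hr (Nat.ne_of_gt h1) hp, hi⟩
  | delTagged i a σ h1 hi =>
    cases hq
    exact ⟨.del hr (Nat.ne_of_gt h1) hp, hi⟩

theorem reach_of_isPath {k : ℕ} {st st' : TState α × Q × Q} {x : List (Option α)}
    (h : (product (T α k) M).IsPath st st' x)
    (hr : StateReach M s₀ st.1.counter st.1.tag st.2.1 st.2.2) :
    StateReach M s₀ st'.1.counter st'.1.tag st'.2.1 st'.2.2 := by
  induction h with
  | nil => exact hr
  | cons t s u a x ht _ ih =>
    obtain ⟨y, he, hp, hq⟩ := ht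
    exact ih (TEdge.reach he hr hp hq).1

/-- Counters never decrease, so everything on the way to counter `i ≤ k` lies inside `T_k`; each
rule of `Reach` appends one edge. -/
theorem Reach.exists_isPath {i k : ℕ} {c : Option α} {p q : Q} (h : StateReach M s₀ i c p q)
    (hk : i ≤ k) :
    ∃ x, (product (T α k) M).IsPath (.plain 0, s₀, s₀) (.ofTag i c, p, q) x := by
  have snoc : ∀ {st st' st'' : TState α × Q × Q} (y : Option α),
      (∃ x, (product (T α k) M).IsPath st st' x) → st'' ∈ (product (T α k) M).step st' y →
      ∃ x, (product (T α k) M).IsPath st st'' x := by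
    rintro st st' st'' y ⟨x, hx⟩ hy
    exact ⟨x ++ [y], (εNFA.isPath_append _).2 ⟨st', hx, (εNFA.isPath_singleton _).2 hy⟩⟩
  induction h with
  | start => exact ⟨[], .nil _⟩
  | @keep i c p q a p' q' h hp hq hc ih =>
    refine snoc (some a) (ih hk) ⟨some a, ?_, hp, hq⟩
    rcases c with _ | b
    · exact .keep i a hk
    · exact .keepTagged i b a (h.tag_spec b rfl).1 hk (by simpa using Ne.symm hc)
  | @sub i c p q a b p' q' h hp hq hab hc ih =>
    refine snoc (some b) (ih (by omega)) ⟨some a, ?_, hp, hq⟩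
    rcases c with _ | e
    · exact .sub i a b hk hab
    · exact .subTagged i e a b (h.tag_spec e rfl).1 hk hab (by simpa using Ne.symm hc)
  | @ins i c p q b q' h hi hq hc ih =>
    refine snoc (some b) (ih (by omega)) ⟨none, ?_, rfl, hq⟩
    rcases c with _ | e
    · exact .ins i b (Nat.pos_of_ne_zero hi) hk
    · exact .insTagged i e b (Nat.pos_of_ne_zero hi) hk (by simpa using Ne.symm hc)
  | @delFirst c p q a p' h hp ih =>
    refine snoc none (ih (by omega)) ⟨some a, ?_, hp, rfl⟩
    obtain rfl := h.zero_spec rfl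
    exact .delFirst a hk
  | @del i c p q a p' h hi hp ih =>
    refine snoc none (ih (by omega)) ⟨some a, ?_, hp, rfl⟩
    rcases c with _ | e
    · exact .del i a (Nat.pos_of_ne_zero hi) hk
    · exact .delTagged i e a (Nat.pos_of_ne_zero hi) hk

theorem hasAcceptingPath_iff (hs : M.start = {s₀}) (k : ℕ) :
    HasAcceptingPath (product (T α k) M) ↔ AcceptsWithin M s₀ k := by
  constructor
  · rintro ⟨⟨φ, p, q⟩, ⟨hφ, hp, hq⟩, ⟨ψ, p', q'⟩, ⟨hψ, hp', hq'⟩, x, hx⟩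
    rw [hs] at hp hq
    obtain rfl : p = s₀ := hp
    obtain rfl : q = p := hq
    obtain rfl : φ = .plain 0 := hφ
    exact ⟨ψ.counter, ψ.tag, p', q', hψ.1, hψ.2, reach_of_isPath hx .start, hp', hq'⟩
  · rintro ⟨i, c, p, q, h1, hk, h, hp, hq⟩
    obtain ⟨x, hx⟩ := h.exists_isPath hk
    refine ⟨_, ⟨rfl, by simp [hs], by simp [hs]⟩, _, ⟨?_, hp, hq⟩, x, hx⟩
    rcases c with _ | a <;> exact ⟨h1, hk⟩

theorem mem_evalFrom_cons {p q : Q} {a : α} {u : List α} :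
    q ∈ M.evalFrom {p} (a :: u) ↔ ∃ p' ∈ M.step p a, q ∈ M.evalFrom {p'} u := by
  rw [NFA.evalFrom_cons, NFA.stepSet_singleton, NFA.mem_evalFrom_iff_exists]

theorem mem_evalFrom_snoc {p q q' : Q} {a : α} {u : List α} (h : q ∈ M.evalFrom {p} u)
    (h' : q' ∈ M.step q a) : q' ∈ M.evalFrom {p} (u ++ [a]) := by
  rw [NFA.evalFrom_append, NFA.evalFrom_singleton, NFA.mem_stepSet]
  exact ⟨q, h, h'⟩

theorem mem_accepts_iff (hs : M.start = {s₀}) {u : List α} :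
    u ∈ M.accepts ↔ ∃ q ∈ M.accept, q ∈ M.evalFrom {s₀} u := by
  rw [NFA.mem_accepts, hs]

/-! ### Accessible states and pairs of different words -/

/-- What the input `u` and the output `v` of a path to a state tell about each other. -/
def Separated (i : ℕ) (u v : List α) : Option α → Prop
  | none => (i = 0 ∧ u = v) ∨
      (i ≠ 0 ∧ ∃ w a b u' v', a ≠ b ∧ u = w ++ a :: u' ∧ v = w ++ b :: v')
  | some a => ∃ u', u = v ++ a :: u'

theorem Separated.ne {i : ℕ} {u v : List α} {c : Option α} (h : Separated i u v c) (hi : 1 ≤ i) :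
    u ≠ v := by
  rintro rfl
  rcases c with _ | a
  · rcases h with h | ⟨_, w, a, b, u', v', hab, h₁, h₂⟩
    · omega
    · rw [h₁] at h₂
      simp [hab] at h₂
  · obtain ⟨u', h⟩ := h
    simp at h

/-- The labels along a path form an edit string, and its weight is the counter because exactly the
error edges raise it. -/
theorem Reach.exists_words {i : ℕ} {c : Option α} {p q : Q} (h : StateReach M s₀ i c p q) :
    ∃ h : List (EditOp α), p ∈ M.evalFrom {s₀} (inp h) ∧ q ∈ M.evalFrom {s₀} (out h) ∧
      weight h = i ∧ Separated i (inp h) (out h) c := by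
  classical
  -- Writing `b` at positive counter leads to a plain state: an existing difference persists, and a
  -- tag `a` becomes a difference because `b ≠ a`.
  have diff : ∀ {i i' : ℕ} {u v : List α} {c : Option α} {b : α} (x : List α),
      Separated i u v c → i ≠ 0 → i' ≠ 0 → some b ≠ c →
      Separated i' (u ++ x) (v ++ [b]) none := by
    rintro i i' u v (_ | a) b x h hi hi' hc
    · obtain ⟨_, w, a, b', u', v', hab, rfl, rfl⟩ := h.resolve_left (by omega)
      exact .inr ⟨hi', w, a, b', u' ++ x, v' ++ [b], hab, by simp, by simp⟩
    · obtain ⟨u', rfl⟩ := h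
      exact .inr ⟨hi', v, a, b, u' ++ x, [], by simpa using Ne.symm hc, by simp, by simp⟩
  induction h with
  | start => exact ⟨[], rfl, rfl, rfl, .inl ⟨rfl, rfl⟩⟩
  | @keep i c p q a p' q' hr hp hq hc ih =>
    obtain ⟨h, h₁, h₂, h₃, h₄⟩ := ih
    refine ⟨h ++ [⟨(some a, some a), by simp⟩], ?_⟩
    simp only [inp_append_singleton, out_append_singleton, weight_append_singleton]
    refine ⟨mem_evalFrom_snoc h₁ hp, mem_evalFrom_snoc h₂ hq, by simpa, ?_⟩
    by_cases hi : i = 0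
    · obtain rfl := hr.zero_spec hi
      rcases h₄ with h₄ | h₄
      · exact .inl ⟨hi, by simp [h₄.2]⟩
      · exact absurd hi h₄.1
    · exact diff _ h₄ hi hi hc
  | @sub i c p q a b p' q' hr hp hq hab hc ih =>
    obtain ⟨h, h₁, h₂, h₃, h₄⟩ := ih
    refine ⟨h ++ [⟨(some a, some b), by simp⟩], ?_⟩
    simp only [inp_append_singleton, out_append_singleton, weight_append_singleton]
    refine ⟨mem_evalFrom_snoc h₁ hp, mem_evalFrom_snoc h₂ hq, by simp [h₃, hab], ?_⟩
    by_cases hi : i = 0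
    · obtain rfl := hr.zero_spec hi
      rcases h₄ with h₄ | h₄
      · exact .inr ⟨by omega, out h, a, b, [], [], hab, by simp [h₄.2], by simp⟩
      · exact absurd hi h₄.1
    · exact diff _ h₄ hi (by omega) hc
  | @ins i c p q b q' hr hi hq hc ih =>
    obtain ⟨h, h₁, h₂, h₃, h₄⟩ := ih
    refine ⟨h ++ [⟨(none, some b), by simp⟩], ?_⟩
    simp only [inp_append_singleton, out_append_singleton, weight_append_singleton]
    exact ⟨by simpa using h₁, mem_evalFrom_snoc h₂ hq, by simp [h₃], diff _ h₄ hi (by omega) hc⟩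
  | @delFirst c p q a p' hr hp ih =>
    obtain ⟨h, h₁, h₂, h₃, h₄⟩ := ih
    refine ⟨h ++ [⟨(some a, none), by simp⟩], ?_⟩
    simp only [inp_append_singleton, out_append_singleton, weight_append_singleton]
    refine ⟨mem_evalFrom_snoc h₁ hp, by simpa using h₂, by simp [h₃], ?_⟩
    obtain rfl := hr.zero_spec rfl
    rcases h₄ with h₄ | h₄
    · exact ⟨[], by simp [h₄.2]⟩
    · exact absurd rfl h₄.1
  | @del i c p q a p' hr hi hp ih =>
    obtain ⟨h, h₁, h₂, h₃, h₄⟩ := ih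
    refine ⟨h ++ [⟨(some a, none), by simp⟩], ?_⟩
    simp only [inp_append_singleton, out_append_singleton, weight_append_singleton]
    refine ⟨mem_evalFrom_snoc h₁ hp, by simpa using h₂, by simp [h₃], ?_⟩
    rcases c with _ | e
    · obtain ⟨_, w, a', b', u', v', hab, h₅, h₆⟩ := h₄.resolve_left (by omega)
      exact .inr ⟨by omega, w, a', b', u' ++ [a], v', hab, by simp [h₅], by simp [h₆]⟩
    · obtain ⟨u', h₅⟩ := h₄
      exact ⟨u' ++ [a], by simp [h₅]⟩

/-- After the first error every operation has an edge unless its output symbol is the current tag,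
which `hc` excludes. A deletion changes neither the tag nor the remaining output; all other
operations clear the tag. -/
theorem Ed.reach {u v : List α} {w : ℕ} (h : Ed u v w) {i : ℕ} {c : Option α} {p q p' q' : Q}
    (hr : StateReach M s₀ i c p q) (hi : i ≠ 0) (hc : ∀ b ∈ v.head?, some b ≠ c)
    (hp : p' ∈ M.evalFrom {p} u) (hq : q' ∈ M.evalFrom {q} v) :
    ∃ c', StateReach M s₀ (i + w) c' p' q' := by
  induction h generalizing i c p q with
  | nil =>
    cases hp
    cases hq
    exact ⟨c, hr⟩
  | keep a h ih =>
    obtain ⟨p₁, h₁, hp⟩ := mem_evalFrom_cons.1 hp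
    obtain ⟨q₁, h₂, hq⟩ := mem_evalFrom_cons.1 hq
    exact ih (hr.keep h₁ h₂ (hc a rfl)) hi (by simp) hp hq
  | @sub _ _ w a b hab h ih =>
    obtain ⟨p₁, h₁, hp⟩ := mem_evalFrom_cons.1 hp
    obtain ⟨q₁, h₂, hq⟩ := mem_evalFrom_cons.1 hq
    rw [show i + (w + 1) = i + 1 + w by omega]
    exact ih (hr.sub h₁ h₂ hab (hc b rfl)) (by omega) (by simp) hp hq
  | @ins _ _ w b h ih =>
    obtain ⟨q₁, h₂, hq⟩ := mem_evalFrom_cons.1 hq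
    rw [show i + (w + 1) = i + 1 + w by omega]
    exact ih (hr.ins hi h₂ (hc b rfl)) (by omega) (by simp) hp hq
  | @del _ _ w a h ih =>
    obtain ⟨p₁, h₁, hp⟩ := mem_evalFrom_cons.1 hp
    rw [show i + (w + 1) = i + 1 + w by omega]
    exact ih (hr.del hi h₁) (by omega) hc hp hq

/-- Equal first letters are cancelled along error-free transitions. Once they differ, the first
operation is an error, and a tag that it creates differs from the next output symbol. Both orders of
the pair `p`, `q` are assumed because a first insertion is handled by exchanging the words. -/
theorem Ed.reach_zero {u v : List α} {w : ℕ} (h : Ed u v w) (hne : u ≠ v) {p q p' q' : Q}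
    (hr : StateReach M s₀ 0 none p q) (hr' : StateReach M s₀ 0 none q p)
    (hp : p' ∈ M.evalFrom {p} u) (hq : q' ∈ M.evalFrom {q} v) :
    ∃ i c, 1 ≤ i ∧ i ≤ w ∧ (StateReach M s₀ i c p' q' ∨ StateReach M s₀ i c q' p') := by
  classical
  induction u generalizing v w p q with
  | nil =>
    cases h with
    | nil => exact absurd rfl hne
    | @ins _ _ w b h =>
      obtain ⟨q₁, h₂, hq⟩ := mem_evalFrom_cons.1 hq
      obtain ⟨c, hc⟩ := h.symm.reach (hr'.delFirst h₂) one_ne_zero (by simp) hq hp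
      exact ⟨1 + w, c, by omega, by omega, .inr hc⟩
  | cons a u ih =>
    by_cases hv : v.head? = some a
    · obtain ⟨v, rfl⟩ : ∃ v', v = a :: v' := List.head?_eq_some_iff.1 hv
      obtain ⟨w', hw, h'⟩ := h.tail
      obtain ⟨p₁, h₁, hp⟩ := mem_evalFrom_cons.1 hp
      obtain ⟨q₁, h₂, hq⟩ := mem_evalFrom_cons.1 hq
      obtain ⟨i, c, h1, hi, hc⟩ := ih h' (by simpa using hne) (hr.keep h₁ h₂ (by simp))
        (hr'.keep h₂ h₁ (by simp)) hp hq
      exact ⟨i, c, h1, by omega, hc⟩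
    · cases h with
      | keep => simp at hv
      | @sub _ _ w _ b hab h =>
        obtain ⟨p₁, h₁, hp⟩ := mem_evalFrom_cons.1 hp
        obtain ⟨q₁, h₂, hq⟩ := mem_evalFrom_cons.1 hq
        obtain ⟨c, hc⟩ := h.reach (hr.sub h₁ h₂ hab (by simp)) (by omega) (by simp) hp hq
        exact ⟨_, c, by omega, by omega, .inl hc⟩
      | @ins _ _ w b h =>
        obtain ⟨q₁, h₂, hq⟩ := mem_evalFrom_cons.1 hq
        -- After the exchange `b` is deleted and becomes the tag, while the remaining output begins
        -- with `a ≠ b`.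
        obtain ⟨c, hc⟩ := h.symm.reach (hr'.delFirst h₂) one_ne_zero
          (by simpa [eq_comm] using hv) hq hp
        exact ⟨1 + w, c, by omega, by omega, .inr hc⟩
      | @del _ _ w _ h =>
        obtain ⟨p₁, h₁, hp⟩ := mem_evalFrom_cons.1 hp
        obtain ⟨c, hc⟩ := h.reach (hr.delFirst h₁) one_ne_zero
          (fun b hb hba => hv (by rw [← hba]; exact hb)) hp hq
        exact ⟨1 + w, c, by omega, by omega, .inl hc⟩

theorem acceptsWithin_iff (hs : M.start = {s₀}) (k : ℕ) :
    AcceptsWithin M s₀ k ↔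
      ∃ u ∈ M.accepts, ∃ v ∈ M.accepts, u ≠ v ∧ editDist u v ≤ k := by
  constructor
  · rintro ⟨i, c, p, q, h1, hk, h, hp, hq⟩
    obtain ⟨h, h₁, h₂, h₃, h₄⟩ := h.exists_words
    exact ⟨_, (mem_accepts_iff hs).2 ⟨p, hp, h₁⟩, _, (mem_accepts_iff hs).2 ⟨q, hq, h₂⟩,
      h₄.ne h1, (editDist_le_weight h).trans (h₃ ▸ hk)⟩
  · rintro ⟨u, hu, v, hv, hne, hk⟩
    obtain ⟨p, hp, hu⟩ := (mem_accepts_iff hs).1 hu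
    obtain ⟨q, hq, hv⟩ := (mem_accepts_iff hs).1 hv
    obtain ⟨i, c, h1, hi, h | h⟩ := (ed_editDist u v).reach_zero hne .start .start hu hv
    · exact ⟨i, c, p, q, h1, by omega, h, hp, hq⟩
    · exact ⟨i, c, q, p, h1, by omega, h, hq, hp⟩

theorem isLeast_langDist (hs : M.start = {s₀})
    (hL : ∃ u ∈ M.accepts, ∃ v ∈ M.accepts, u ≠ v) :
    IsLeast {k | AcceptsWithin M s₀ k} (langDist M.accepts) := by
  obtain ⟨u, hu, v, hv, hne⟩ := hL
  constructor
  · obtain ⟨u', hu', v', hv', hne', h⟩ := Nat.sInf_mem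
      (s := {d | ∃ u ∈ M.accepts, ∃ v ∈ M.accepts, u ≠ v ∧ editDist u v = d})
      ⟨_, u, hu, v, hv, hne, rfl⟩
    exact (acceptsWithin_iff hs _).2 ⟨u', hu', v', hv', hne', h.le⟩
  · intro k hk
    obtain ⟨u, hu, v, hv, hne, h⟩ := (acceptsWithin_iff hs _).1 hk
    exact le_trans (Nat.sInf_le ⟨u, hu, v, hv, hne, rfl⟩) h

end Automaton

/-! ### Renaming states and symbols -/

section Rename

variable {α Q : Type*} {M : NFA α Q} {s₀ : Q} {f : Q → ℕ} {g : α → ℕ} {tr : ℕ → ℕ → ℕ → Prop}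

/-- The number of a kind, for a numbering of the symbols. -/
def tagNum (g : α → ℕ) : Option α → ℕ
  | none => 0
  | some a => g a + 1

/-- Distinct numbers are needed only on the used alphabet, which contains the labels of all
transitions and all tags. -/
theorem Reach.rename (hg : Set.InjOn g (usedAlphabet M))
    (htr : ∀ x y z, tr x y z ↔ ∃ t ∈ transitions M, f t.1 = x ∧ g t.2.1 = y ∧ f t.2.2 = z)
    {i : ℕ} {c : Option α} {p q : Q} (h : StateReach M s₀ i c p q) :
    Reach tr (f s₀) 0 (· + 1) i (tagNum g c) (f p) (f q) := by
  have htr' : ∀ {p a q}, q ∈ M.step p a → tr (f p) (g a) (f q) :=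
    fun {p a q} h => (htr _ _ _).2 ⟨(p, a, q), h, rfl, rfl, rfl⟩
  have hc' : ∀ {i c p q p' q' a}, StateReach M s₀ i c p q → q' ∈ M.step p' a → some a ≠ c →
      g a + 1 ≠ tagNum g c := by
    rintro i (_ | b) p q p' q' a hr h hne he
    · exact Nat.succ_ne_zero _ he
    · exact hne (congrArg some
        (hg ⟨_, _, h⟩ (hr.tag_spec b rfl).2 (Nat.succ_injective he)))
  induction h with
  | start => exact .start
  | keep hr hp hq hc ih => exact ih.keep (htr' hp) (htr' hq) (hc' hr hq hc)
  | sub hr hp hq hab hc ih =>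
    exact ih.sub (htr' hp) (htr' hq) (fun he => hab (hg ⟨_, _, hp⟩ ⟨_, _, hq⟩ he)) (hc' hr hq hc)
  | ins hr hi hq hc ih => exact ih.ins hi (htr' hq) (hc' hr hq hc)
  | delFirst hr hp ih => exact ih.delFirst (htr' hp)
  | del hr hi hp ih => exact ih.del hi (htr' hp)

/-- This direction also needs distinct numbers for states: a numbered transition out of `f p` must
come from a transition out of `p` itself. -/
theorem Reach.of_rename (hf : Function.Injective f) (hg : Set.InjOn g (usedAlphabet M))
    (htr : ∀ x y z, tr x y z ↔ ∃ t ∈ transitions M, f t.1 = x ∧ g t.2.1 = y ∧ f t.2.2 = z)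
    {i d x y : ℕ} (h : Reach tr (f s₀) 0 (· + 1) i d x y) :
    ∃ c p q, d = tagNum g c ∧ x = f p ∧ y = f q ∧ StateReach M s₀ i c p q := by
  have htr' : ∀ {p y z}, tr (f p) y z → ∃ a q, q ∈ M.step p a ∧ y = g a ∧ z = f q := by
    intro p y z h
    obtain ⟨⟨p', a, q⟩, h₁, h₂, rfl, rfl⟩ := (htr _ _ _).1 h
    obtain rfl := hf h₂
    exact ⟨a, q, h₁, rfl, rfl⟩
  have hc' : ∀ {a c}, g a + 1 ≠ tagNum g c → some a ≠ c := by
    rintro a _ h rfl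
    exact h rfl
  induction h with
  | start => exact ⟨none, s₀, s₀, rfl, rfl, rfl, .start⟩
  | keep _ hp hq hc ih =>
    obtain ⟨c, p, q, rfl, rfl, rfl, hr⟩ := ih
    obtain ⟨a, p', hp', rfl, rfl⟩ := htr' hp
    obtain ⟨b, q', hq', hab, rfl⟩ := htr' hq
    obtain rfl := hg ⟨_, _, hp'⟩ ⟨_, _, hq'⟩ hab
    exact ⟨none, p', q', rfl, rfl, rfl, hr.keep hp' hq' (hc' hc)⟩
  | sub _ hp hq hab hc ih =>
    obtain ⟨c, p, q, rfl, rfl, rfl, hr⟩ := ih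
    obtain ⟨a, p', hp', rfl, rfl⟩ := htr' hp
    obtain ⟨b, q', hq', rfl, rfl⟩ := htr' hq
    exact ⟨none, p', q', rfl, rfl, rfl, hr.sub hp' hq' (fun h => hab (congrArg g h)) (hc' hc)⟩
  | ins _ hi hq hc ih =>
    obtain ⟨c, p, q, rfl, rfl, rfl, hr⟩ := ih
    obtain ⟨b, q', hq', rfl, rfl⟩ := htr' hq
    exact ⟨none, p, q', rfl, rfl, rfl, hr.ins hi hq' (hc' hc)⟩
  | delFirst _ hp ih =>
    obtain ⟨c, p, q, rfl, rfl, rfl, hr⟩ := ih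
    obtain ⟨a, p', hp', rfl, rfl⟩ := htr' hp
    exact ⟨some a, p', q, rfl, rfl, rfl, hr.delFirst hp'⟩
  | del _ hi hp ih =>
    obtain ⟨c, p, q, rfl, rfl, rfl, hr⟩ := ih
    obtain ⟨a, p', hp', rfl, rfl⟩ := htr' hp
    exact ⟨c, p', q, rfl, rfl, rfl, hr.del hi hp'⟩

end Rename

/-! ### Weakest preconditions with step counts -/

/-- Started in `s`, the command `c` halts, and the number of steps and the final store satisfy
`post`. -/
def Wp (c : Cmd) (s : Store) (post : ℕ → Store → Prop) : Prop :=
  ∃ t s', Run c s t s' ∧ post t s'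

section Wp

variable {c d : Cmd} {s : Store} {post post' : ℕ → Store → Prop}

theorem Wp.mono (h : Wp c s post) (hp : ∀ t s', post t s' → post' t s') : Wp c s post' := by
  obtain ⟨t, s', hr, h⟩ := h
  exact ⟨t, s', hr, hp t s' h⟩

theorem wp_set {x : Reg} {e : Expr} :
    Wp (.set x e) s post ↔ post (e.cost + 1) (s.setReg x (e.eval s)) :=
  ⟨by rintro ⟨t, s', hr, h⟩; cases hr; exact h, fun h => ⟨_, _, .set x e s, h⟩⟩

theorem wp_put {a : Arr} {e f : Expr} :
    Wp (.put a e f) s post ↔ post (e.cost + f.cost + 1) (s.setArr a (e.eval s) (f.eval s)) :=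
  ⟨by rintro ⟨t, s', hr, h⟩; cases hr; exact h, fun h => ⟨_, _, .put a e f s, h⟩⟩

theorem wp_skip : Wp .skip s post ↔ post 1 s :=
  ⟨by rintro ⟨t, s', hr, h⟩; cases hr; exact h, fun h => ⟨_, _, .skip s, h⟩⟩

theorem wp_seq : Wp (.seq c d) s post ↔
    Wp c s fun t s' => Wp d s' fun t' s'' => post (t + t') s'' := by
  constructor
  · rintro ⟨t, s', hr, h⟩
    cases hr with
    | seq h₁ h₂ => exact ⟨_, _, h₁, _, _, h₂, h⟩
  · rintro ⟨t, s', h₁, t', s'', h₂, h⟩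
    exact ⟨_, _, .seq h₁ h₂, h⟩

theorem wp_ite_true {b : Test} (hb : b.eval s = true) :
    Wp (.ite b c d) s post ↔ Wp c s fun t s' => post (b.cost + 1 + t) s' := by
  constructor
  · rintro ⟨t, s', hr, h⟩
    cases hr with
    | iteTrue _ hr => exact ⟨_, _, hr, h⟩
    | iteFalse hb' _ => simp [hb] at hb'
  · rintro ⟨t, s', hr, h⟩
    exact ⟨_, _, .iteTrue hb hr, h⟩

theorem wp_ite_false {b : Test} (hb : b.eval s = false) :
    Wp (.ite b c d) s post ↔ Wp d s fun t s' => post (b.cost + 1 + t) s' := by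
  constructor
  · rintro ⟨t, s', hr, h⟩
    cases hr with
    | iteFalse _ hr => exact ⟨_, _, hr, h⟩
    | iteTrue hb' _ => simp [hb] at hb'
  · rintro ⟨t, s', hr, h⟩
    exact ⟨_, _, .iteFalse hb hr, h⟩

theorem Wp.loop_false {b : Test} (hb : b.eval s = false) (h : post (b.cost + 1) s) :
    Wp (.loop b c) s post :=
  ⟨_, _, .loopFalse hb, h⟩

theorem Wp.loop_true {b : Test} (hb : b.eval s = true)
    (h : Wp c s fun t s' => Wp (.loop b c) s' fun t' s'' => post (b.cost + 1 + t + t') s'') :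
    Wp (.loop b c) s post := by
  obtain ⟨t, s', h₁, t', s'', h₂, h⟩ := h
  exact ⟨_, _, .loopTrue hb h₁ h₂, h⟩

theorem Wp.seq {p : ℕ → Store → Prop} (h : Wp c s p)
    (h' : ∀ t s', p t s' → Wp d s' fun t' s'' => post (t + t') s'') : Wp (.seq c d) s post :=
  wp_seq.2 (h.mono h')

end Wp

section Eval

variable {s : Store} {x : Reg} {v : ℕ}

@[simp] theorem Expr.eval_hadd (e f : Expr) : (e + f).eval s = e.eval s + f.eval s := rfl
@[simp] theorem Expr.eval_hmul (e f : Expr) : (e * f).eval s = e.eval s * f.eval s := rfl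
@[simp] theorem Expr.eval_zero : Expr.eval s 0 = 0 := rfl
@[simp] theorem Expr.eval_one : Expr.eval s 1 = 1 := rfl
@[simp] theorem Expr.eval_reg : (Expr.reg x).eval s = s.reg x := rfl
@[simp] theorem Expr.eval_get (a : Arr) (e : Expr) : (Expr.get a e).eval s = s.arr a (e.eval s) :=
  rfl
@[simp] theorem Expr.cost_hadd (e f : Expr) : (e + f).cost = e.cost + f.cost + 1 := rfl
@[simp] theorem Expr.cost_hmul (e f : Expr) : (e * f).cost = e.cost + f.cost + 1 := rfl
@[simp] theorem Expr.cost_zero : Expr.cost 0 = 1 := rfl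
@[simp] theorem Expr.cost_one : Expr.cost 1 = 1 := rfl
@[simp] theorem Expr.cost_reg : (Expr.reg x).cost = 1 := rfl
@[simp] theorem Expr.cost_get (a : Arr) (e : Expr) : (Expr.get a e).cost = e.cost + 1 := rfl

@[simp] theorem Store.reg_setReg (y : Reg) :
    (s.setReg x v).reg y = if y = x then v else s.reg y := by
  simp [Store.setReg, Function.update_apply]

@[simp] theorem Store.arr_setReg : (s.setReg x v).arr = s.arr := rfl

@[simp] theorem Store.reg_setArr (a : Arr) (i : ℕ) : (s.setArr a i v).reg = s.reg := rfl

theorem Store.arr_setArr (a b : Arr) (i : ℕ) :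
    (s.setArr a i v).arr b = if b = a then Function.update (s.arr a) i v else s.arr b := by
  by_cases h : b = a
  · subst h; simp [Store.setArr]
  · simp [Store.setArr, h]

@[simp] theorem Store.arr_setArr_self (a : Arr) (i : ℕ) :
    (s.setArr a i v).arr a = Function.update (s.arr a) i v := by
  simp [Store.arr_setArr]

@[simp] theorem Store.arr_setArr_ne (a b : Arr) (i : ℕ) (h : b ≠ a) :
    (s.setArr a i v).arr b = s.arr b := by
  simp [Store.arr_setArr, h]

end Eval

/-! ### Frames -/

/-- The arrays of the product tables. -/
def tableArrays : List Arr := [.idx, .kind, .left, .right, .eSrc, .eIn, .eOut, .eDst]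

/-- The two stores differ in the registers in `X` and in the product tables only. -/
structure Agree (X : List Reg) (s s' : Store) : Prop where
  reg : ∀ x, x ∉ X → s'.reg x = s.reg x
  arr : ∀ a, a ∉ tableArrays → s'.arr a = s.arr a

theorem Agree.refl (X : List Reg) (s : Store) : Agree X s s := ⟨fun _ _ => rfl, fun _ _ => rfl⟩

theorem Agree.trans {X : List Reg} {s s' s'' : Store} (h : Agree X s s') (h' : Agree X s' s'') :
    Agree X s s'' :=
  ⟨fun x hx => (h'.reg x hx).trans (h.reg x hx), fun a ha => (h'.arr a ha).trans (h.arr a ha)⟩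

theorem Agree.mono {X Y : List Reg} {s s' : Store} (h : Agree X s s') (hXY : X ⊆ Y) :
    Agree Y s s' :=
  ⟨fun x hx => h.reg x fun hx' => hx (hXY hx'), h.arr⟩

theorem Agree.setReg {X : List Reg} {s s' : Store} {x : Reg} {v : ℕ} (h : Agree X s s')
    (hx : x ∈ X) : Agree X s (s'.setReg x v) := by
  refine ⟨fun y hy => ?_, h.arr⟩
  have : y ≠ x := by rintro rfl; exact hy hx
  simp [this, h.reg y hy]

theorem Agree.setArr {X : List Reg} {s s' : Store} {a : Arr} {i v : ℕ} (h : Agree X s s')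
    (ha : a ∈ tableArrays) : Agree X s (s'.setArr a i v) := by
  refine ⟨h.reg, fun b hb => ?_⟩
  have : b ≠ a := by rintro rfl; exact hb ha
  simp [this, h.arr b hb]

/-! ### Product states as table rows -/

/-- A numbered product state: error counter, kind, and two states of the automaton. -/
@[ext]
structure Item where
  lv : ℕ
  c : ℕ
  p : ℕ
  q : ℕ
  deriving DecidableEq

/-- The kind and the components are in range for `n` states and `r` symbols. -/
def Item.Valid (n r : ℕ) (x : Item) : Prop := x.c ≤ r ∧ x.p < n ∧ x.q < n

/-- The position of a product state in the table `idx`. -/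
def Item.position (n r : ℕ) (x : Item) : ℕ := ((x.lv * (r + 1) + x.c) * n + x.p) * n + x.q

theorem mul_add_inj {n a b c d : ℕ} (hb : b < n) (hd : d < n) (h : a * n + b = c * n + d) :
    a = c ∧ b = d := by
  have h₁ : (a * n + b) % n = (c * n + d) % n := by rw [h]
  rw [Nat.mul_add_mod', Nat.mul_add_mod', Nat.mod_eq_of_lt hb, Nat.mod_eq_of_lt hd] at h₁
  subst h₁
  exact ⟨Nat.eq_of_mul_eq_mul_right (by omega) (Nat.add_right_cancel h), rfl⟩

/-- The position is a Horner form with digits below `r + 1`, `n`, `n`; the counter is the leading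
digit and needs no bound. -/
theorem Item.position_inj {n r : ℕ} {x y : Item} (hx : x.Valid n r) (hy : y.Valid n r)
    (h : x.position n r = y.position n r) : x = y := by
  obtain ⟨h₁, h₂, h₃⟩ := hx
  obtain ⟨h₁', h₂', h₃'⟩ := hy
  obtain ⟨h, hq⟩ := mul_add_inj h₃ h₃' h
  obtain ⟨h, hp⟩ := mul_add_inj h₂ h₂' h
  obtain ⟨hl, hc⟩ := mul_add_inj (Nat.lt_succ_of_le h₁) (Nat.lt_succ_of_le h₁') h
  exact Item.ext hl hc hp hq

/-- The tables of the store hold the product states in `L`, in this order. -/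
structure Tab (n r : ℕ) (s : Store) (L : List Item) : Prop where
  cnt : s.reg .cnt = L.length
  nodup : L.Nodup
  valid : ∀ x ∈ L, x.Valid n r
  -- Only the vanishing of an entry is tracked. Its value enters just the transition tables, which
  -- are written but never read.
  idx : ∀ x : Item, x.Valid n r → (s.arr .idx (x.position n r) = 0 ↔ x ∉ L)
  row : ∀ j x, L[j]? = some x →
    s.arr .kind (j + 1) = x.c ∧ s.arr .left (j + 1) = x.p ∧ s.arr .right (j + 1) = x.q

theorem Tab.congr {n r : ℕ} {s s' : Store} {L : List Item} (h : Tab n r s L)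
    (hc : s'.reg .cnt = s.reg .cnt)
    (ha : ∀ a, a ∈ [Arr.idx, .kind, .left, .right] → s'.arr a = s.arr a) : Tab n r s' L := by
  refine ⟨hc.trans h.cnt, h.nodup, h.valid, ?_, ?_⟩
  · rw [ha _ (by simp)]; exact h.idx
  · rw [ha .kind (by simp), ha .left (by simp), ha .right (by simp)]; exact h.row

theorem Tab.setReg {n r : ℕ} {s : Store} {L : List Item} (h : Tab n r s L) {x : Reg} {v : ℕ}
    (hx : x ≠ .cnt) : Tab n r (s.setReg x v) L :=
  h.congr (by simp [hx.symm]) fun _ _ => rfl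

/-- `L'` extends `L` at the end, by exactly those states with property `B` that are not in `L`. -/
structure Ext (L : List Item) (B : Item → Prop) (L' : List Item) : Prop where
  isPrefix : L <+: L'
  mem_iff : ∀ y, y ∈ L' ↔ y ∈ L ∨ B y

theorem Ext.refl (L : List Item) : Ext L (fun _ => False) L := ⟨List.prefix_rfl, by simp⟩

theorem Ext.trans {L L' L'' : List Item} {B B' : Item → Prop} (h : Ext L B L')
    (h' : Ext L' B' L'') : Ext L (fun y => B y ∨ B' y) L'' :=
  ⟨h.isPrefix.trans h'.isPrefix, fun y => by rw [h'.mem_iff, h.mem_iff, or_assoc]⟩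

theorem Ext.congr {L L' : List Item} {B B' : Item → Prop} (h : Ext L B L')
    (hB : ∀ y, B y ↔ B' y) : Ext L B' L' :=
  ⟨h.isPrefix, fun y => by rw [h.mem_iff, hB]⟩

/-- The command adds the states with property `B` to the tables, in at most `T` steps, and changes
no registers but those in `X`. -/
def Adds (n r : ℕ) (X : List Reg) (c : Cmd) (T : ℕ) (s : Store) (L : List Item)
    (B : Item → Prop) : Prop :=
  Wp c s fun t s' => t ≤ T ∧ Agree X s s' ∧ ∃ L', Tab n r s' L' ∧ Ext L B L'

/-! ### Commands that add product states -/

section Adds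

variable {n r T T' : ℕ} {X : List Reg} {c d : Cmd} {s : Store} {L : List Item}
  {B B' : Item → Prop}

theorem Adds.congr (h : Adds n r X c T s L B) (hT : T ≤ T') (hB : ∀ y, B y ↔ B' y) :
    Adds n r X c T' s L B' :=
  h.mono fun _ _ ⟨ht, ha, L', h₁, h₂⟩ => ⟨ht.trans hT, ha, L', h₁, h₂.congr hB⟩

theorem Adds.mono_regs {Y : List Reg} (h : Adds n r X c T s L B) (hXY : X ⊆ Y) :
    Adds n r Y c T s L B :=
  h.mono fun _ _ ⟨ht, ha, h⟩ => ⟨ht, ha.mono hXY, h⟩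

theorem Adds.seq (h : Adds n r X c T s L B)
    (h' : ∀ s' L', Agree X s s' → Tab n r s' L' → Adds n r X d T' s' L' B') :
    Adds n r X (.seq c d) (T + T') s L (fun y => B y ∨ B' y) := by
  refine Wp.seq h ?_
  rintro t s' ⟨ht, ha, L', h₁, h₂⟩
  refine (h' s' L' ha h₁).mono ?_
  rintro t' s'' ⟨ht', ha', L'', h₁', h₂'⟩
  exact ⟨by omega, ha.trans ha', L'', h₁', h₂.trans h₂'⟩

theorem Adds.ite_skip {b : Test} {P : Prop} (hL : Tab n r s L) (hb : b.eval s = true ↔ P)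
    (h : P → Adds n r X c T s L B) :
    Adds n r X (.ite b c .skip) (b.cost + 2 + T) s L (fun y => P ∧ B y) := by
  by_cases hP : P
  · refine (wp_ite_true (hb.2 hP)).2 ((h hP).mono ?_)
    rintro t s' ⟨ht, ha, L', h₁, h₂⟩
    exact ⟨by omega, ha, L', h₁, h₂.congr (by simp [hP])⟩
  · refine (wp_ite_false (by rw [← Bool.not_eq_true, hb]; exact hP)).2 (wp_skip.2 ?_)
    exact ⟨by omega, .refl _ _, L, hL, (Ext.refl L).congr (by simp [hP])⟩

/-- The kind and the components are evaluated twice, the second time after `code`, `cnt` and some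
tables have changed. Hence their values are required in all agreeing stores, and their costs count
double. -/
theorem adds_addState {lv e f g : Expr} {x : Item} (hn : s.reg .nQ = n) (hr : s.reg .nS = r)
    (hL : Tab n r s L) (hx : x.Valid n r)
    (he : ∀ s', Agree [.code, .cnt] s s' →
      lv.eval s' = x.lv ∧ e.eval s' = x.c ∧ f.eval s' = x.p ∧ g.eval s' = x.q) :
    Adds n r [.code, .cnt] (addState lv e f g)
      (lv.cost + 2 * (e.cost + f.cost + g.cost) + 40) s L (· = x) := by
  have hcode : (((lv * (Reg.nS + 1) + e) * Reg.nQ + f) * Reg.nQ + g : Expr).eval s =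
      x.position n r := by
    obtain ⟨h₁, h₂, h₃, h₄⟩ := he s (.refl _ _)
    simp [Item.position, h₁, h₂, h₃, h₄, hn, hr]
  unfold Adds addState
  rw [wp_seq, wp_set, hcode]
  set s₁ := s.setReg .code (x.position n r) with hs₁
  have ha₁ : Agree [.code, .cnt] s s₁ := (Agree.refl _ s).setReg (by simp)
  have hL₁ : Tab n r s₁ L := hL.setReg (by simp)
  by_cases hm : x ∈ L
  · rw [wp_ite_false, wp_skip]
    · refine ⟨?_, ha₁, L, hL₁, List.prefix_rfl, ?_⟩
      · simp [Test.cost]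
        omega
      · intro y
        constructor
        · exact .inl
        · rintro (h | rfl)
          exacts [h, hm]
    · simpa [Test.eval, hs₁, hL.idx x hx] using hm
  · rw [wp_ite_true]
    · simp only [wp_seq, wp_set, wp_put]
      set s₂ := s₁.setReg .cnt ((Reg.cnt + 1 : Expr).eval s₁) with hs₂
      have hc₂ : s₂.reg .cnt = L.length + 1 := by simp [hs₂, hL₁.cnt]
      have ha₂ : Agree [.code, .cnt] s s₂ := ha₁.setReg (by simp)
      obtain ⟨-, h₂, -, -⟩ := he s₂ ha₂
      set s₃ := s₂.setArr .kind (Expr.eval s₂ Reg.cnt) (e.eval s₂) with hs₃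
      have ha₃ : Agree [.code, .cnt] s s₃ := ha₂.setArr (by simp [tableArrays])
      obtain ⟨-, -, h₃, -⟩ := he s₃ ha₃
      set s₄ := s₃.setArr .left (Expr.eval s₃ Reg.cnt) (f.eval s₃) with hs₄
      have ha₄ : Agree [.code, .cnt] s s₄ := ha₃.setArr (by simp [tableArrays])
      obtain ⟨-, -, -, h₄⟩ := he s₄ ha₄
      set s₅ := s₄.setArr .right (Expr.eval s₄ Reg.cnt) (g.eval s₄) with hs₅
      have ha₅ : Agree [.code, .cnt] s s₅ := ha₄.setArr (by simp [tableArrays])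
      have hc : s₂.reg .code = x.position n r := by simp [hs₂, hs₁]
      rw [h₂] at hs₃
      rw [h₃] at hs₄
      rw [h₄] at hs₅
      refine ⟨?_, ha₅.setArr (by simp [tableArrays]), L ++ [x], ⟨?_, ?_, ?_, ?_, ?_⟩, ?_, ?_⟩
      · simp [Test.cost]
        omega
      · simp [hs₅, hs₄, hs₃, hc₂]
      · rw [List.nodup_append]
        refine ⟨hL.nodup, List.nodup_singleton x, ?_⟩
        rintro a ha b hb rfl
        rw [List.mem_singleton] at hb
        exact hm (hb ▸ ha)
      · intro y hy
        rw [List.mem_append, List.mem_singleton] at hy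
        rcases hy with hy | rfl
        exacts [hL.valid y hy, hx]
      · intro y hy
        by_cases hyx : y = x
        · subst hyx
          simp [hs₅, hs₄, hs₃, hc, hc₂]
        -- Different valid states have different positions, so the new entry of `idx` disturbs no
        -- other.
        · have : y.position n r ≠ x.position n r := fun h => hyx (Item.position_inj hy hx h)
          simp [hs₅, hs₄, hs₃, hs₂, hs₁, this, hyx, hL.idx y hy]
      · intro j y hj
        by_cases hjL : j < L.length
        · rw [List.getElem?_append_left hjL] at hj
          obtain ⟨h₅, h₆, h₇⟩ := hL.row j y hj
          have : j ≠ L.length := hjL.ne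
          simp [hs₅, hs₄, hs₃, hs₂, hs₁, hL.cnt, this, h₅, h₆, h₇]
        · obtain ⟨rfl, rfl⟩ : j = L.length ∧ y = x := by
            rw [List.getElem?_append_right (by omega), List.getElem?_eq_some_iff] at hj
            obtain ⟨h, h'⟩ := hj
            simp at h
            simp at h'
            exact ⟨by omega, h'.symm⟩
          simp [hs₅, hs₄, hs₃, hc₂]
      · exact List.prefix_append _ _
      · simp
    · simpa [Test.eval, hs₁, hL.idx x hx] using hm

/-- The registers that change when a transition is added. -/
def countRegs : List Reg := [.code, .cnt, .ecnt]

theorem adds_addTrans {a b lv e f g : Expr} {x : Item} (hn : s.reg .nQ = n) (hr : s.reg .nS = r)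
    (hL : Tab n r s L) (hx : x.Valid n r)
    (he : ∀ s', Agree [.code, .cnt] s s' →
      lv.eval s' = x.lv ∧ e.eval s' = x.c ∧ f.eval s' = x.p ∧ g.eval s' = x.q) :
    Adds n r countRegs (addTrans a b lv e f g)
      (a.cost + b.cost + lv.cost + 2 * (e.cost + f.cost + g.cost) + 60) s L (· = x) := by
  refine Wp.seq (adds_addState hn hr hL hx he) ?_
  rintro t s' ⟨ht, ha, L', hL', hE⟩
  simp only [wp_seq, wp_set, wp_put]
  refine ⟨?_, ?_, L', hL'.congr (by simp) ?_, hE⟩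
  · simp
    omega
  · replace ha : Agree countRegs s s' := ha.mono (by simp [countRegs])
    exact ((((ha.setArr (by simp [tableArrays])).setArr (by simp [tableArrays])).setArr
      (by simp [tableArrays])).setArr (by simp [tableArrays])).setReg (by simp [countRegs])
  · intro a ha
    simp only [List.mem_cons, List.not_mem_nil, or_false] at ha
    rcases ha with rfl | rfl | rfl | rfl <;> simp

/-- The body leaves `x` and `v` alone, and no command here touches `first`, so the range of the loop
is fixed at its start. The extra 20 steps per round cover the test and the increment. -/
theorem adds_forOut {x v : Reg} {body : Cmd} {B : ℕ → Item → Prop} (hx : x ∉ X) (hv : v ∉ x :: X)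
    (hxc : x ≠ .cnt) (hL : Tab n r s L)
    (hbody : ∀ i s' L', s.arr .first (s.reg v) ≤ i → i < s.arr .first (s.reg v + 1) →
      Agree (x :: X) s s' → s'.reg x = i → Tab n r s' L' → Adds n r X body T s' L' (B i)) :
    Adds n r (x :: X) (forOut x v body)
      ((s.arr .first (s.reg v + 1) - s.arr .first (s.reg v)) * (T + 20) + 20) s L
      (fun y => ∃ i, s.arr .first (s.reg v) ≤ i ∧ i < s.arr .first (s.reg v + 1) ∧ B i y) := by
  set lo := s.arr .first (s.reg v)
  set hi := s.arr .first (s.reg v + 1)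
  have key : ∀ N i s' L', hi - i = N → lo ≤ i → Agree (x :: X) s s' → s'.reg x = i →
      Tab n r s' L' →
      Adds n r (x :: X) (.loop (.lt x (.get .first ((v : Expr) + 1)))
        (body ;; x ≔ (x : Expr) + 1)) (N * (T + 20) + 15) s' L'
        (fun y => ∃ l, i ≤ l ∧ l < hi ∧ B l y) := by
    intro N
    induction N with
    | zero =>
      intro i s' L' hN hlo ha hi' hL'
      refine Wp.loop_false ?_ ⟨?_, .refl _ _, L', hL', (Ext.refl _).congr fun y => ?_⟩
      · simp [Test.eval, hi', ha.reg v hv, ha.arr .first (by simp [tableArrays])]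
        omega
      · simp [Test.cost]
      · simp only [false_iff, not_exists]
        intro l h
        omega
    | succ N ih =>
      intro i s' L' hN hlo ha hi' hL'
      refine Wp.loop_true ?_ (Wp.seq (hbody i s' L' hlo (by omega) ha hi' hL') ?_)
      · simp [Test.eval, hi', ha.reg v hv, ha.arr .first (by simp [tableArrays])]
        omega
      · rintro t s₁ ⟨ht, ha₁, L₁, hL₁, hE₁⟩
        rw [wp_set]
        have ha₁' : Agree (x :: X) s' s₁ := ha₁.mono (by simp)
        have hxi : s₁.reg x = i := by rw [ha₁.reg x hx, hi']
        refine (ih (i + 1) _ L₁ (by omega) (by omega) ((ha.trans ha₁').setReg (by simp))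
          (by simp [hxi]) (hL₁.setReg hxc)).mono ?_
        rintro t' s₂ ⟨ht', ha₂, L₂, hL₂, hE₂⟩
        refine ⟨?_, (ha₁'.setReg (by simp)).trans ha₂, L₂, hL₂, (hE₁.trans hE₂).congr ?_⟩
        · simp [Test.cost, Nat.add_mul]
          omega
        · intro y
          constructor
          · rintro (h | ⟨l, h₁, h₂, h₃⟩)
            · exact ⟨i, le_rfl, by omega, h⟩
            · exact ⟨l, by omega, h₂, h₃⟩
          · rintro ⟨l, h₁, h₂, h₃⟩
            rcases Nat.eq_or_lt_of_le h₁ with rfl | h₁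
            · exact .inl h₃
            · exact .inr ⟨l, h₁, h₂, h₃⟩
  unfold Adds forOut
  rw [wp_seq, wp_set]
  refine (key _ lo _ L rfl le_rfl ((Agree.refl _ s).setReg (by simp)) (by simp [lo])
    (hL.setReg hxc)).mono ?_
  rintro t s' ⟨ht, ha, h⟩
  refine ⟨?_, ((Agree.refl _ s).setReg (by simp)).trans ha, h⟩
  simp
  omega

end Adds

/-! ### The automaton as it is stored after the preparation -/

/-- An automaton with states `0, …, n - 1` and symbols `0, …, r - 1`: the transitions out of `p` are
`(p, lab i, dst i)` with `first p ≤ i < first (p + 1)`, and `fin` indicates the final states. -/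
structure Graph where
  n : ℕ
  r : ℕ
  start : ℕ
  first : ℕ → ℕ
  lab : ℕ → ℕ
  dst : ℕ → ℕ
  fin : ℕ → ℕ

namespace Graph

/-- The transitions. -/
def tr (G : Graph) (p a q : ℕ) : Prop :=
  ∃ i, G.first p ≤ i ∧ i < G.first (p + 1) ∧ G.lab i = a ∧ G.dst i = q

/-- All numbers are in range. -/
structure Wf (G : Graph) : Prop where
  start : G.start < G.n
  lab : ∀ p < G.n, ∀ i, G.first p ≤ i → i < G.first (p + 1) → G.lab i < G.r
  dst : ∀ p < G.n, ∀ i, G.first p ≤ i → i < G.first (p + 1) → G.dst i < G.n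

/-- One more than the number of transitions out of `p`. -/
def deg (G : Graph) (p : ℕ) : ℕ := G.first (p + 1) - G.first p + 1

/-- The accessible product states. -/
def Reaches (G : Graph) (x : Item) : Prop := Reach G.tr G.start 0 (· + 1) x.lv x.c x.p x.q

/-- The product transitions without error. -/
def KeepSucc (G : Graph) (x y : Item) : Prop :=
  ∃ a p q, G.tr x.p a p ∧ G.tr x.q a q ∧ a + 1 ≠ x.c ∧ y = ⟨x.lv, 0, p, q⟩

/-- The product transitions with a substitution. -/
def SubSucc (G : Graph) (x y : Item) : Prop :=
  ∃ a b p q, G.tr x.p a p ∧ G.tr x.q b q ∧ a ≠ b ∧ b + 1 ≠ x.c ∧ y = ⟨x.lv + 1, 0, p, q⟩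

/-- The product transitions with an insertion. -/
def InsSucc (G : Graph) (x y : Item) : Prop :=
  ∃ b q, G.tr x.q b q ∧ b + 1 ≠ x.c ∧ y = ⟨x.lv + 1, 0, x.p, q⟩

/-- The product transitions with a deletion. -/
def DelSucc (G : Graph) (x y : Item) : Prop :=
  ∃ a p, G.tr x.p a p ∧ y = ⟨x.lv + 1, if x.lv = 0 then a + 1 else x.c, p, x.q⟩

/-- The product transitions with an error. -/
def ErrSucc (G : Graph) (x y : Item) : Prop :=
  G.SubSucc x y ∨ (x.lv ≠ 0 ∧ G.InsSucc x y) ∨ G.DelSucc x y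

variable {G : Graph}

theorem KeepSucc.reaches {x y : Item} (h : G.KeepSucc x y) (hx : G.Reaches x) : G.Reaches y := by
  obtain ⟨a, p, q, hp, hq, hc, rfl⟩ := h
  exact Reach.keep hx hp hq hc

theorem ErrSucc.reaches {x y : Item} (h : G.ErrSucc x y) (hx : G.Reaches x) : G.Reaches y := by
  rcases x with ⟨k, c, x₁, x₂⟩
  rcases h with ⟨a, b, p, q, hp, hq, hab, hc, rfl⟩ | ⟨h0, b, q, hq, hc, rfl⟩ | ⟨a, p, hp, rfl⟩
  · exact Reach.sub hx hp hq hab hc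
  · exact Reach.ins hx h0 hq hc
  · by_cases h0 : k = 0
    · subst h0
      exact Reach.delFirst hx hp
    · simp only [h0, if_false]
      exact Reach.del hx h0 hp

theorem ErrSucc.lv {x y : Item} (h : G.ErrSucc x y) : y.lv = x.lv + 1 := by
  rcases h with ⟨a, b, p, q, hp, hq, hab, hc, rfl⟩ | ⟨h0, b, q, hq, hc, rfl⟩ | ⟨a, p, hp, rfl⟩ <;>
    rfl

/-- The states of counter `k` are those without predecessor or after an error, and those that are
reached from them without error. -/
theorem Reaches.mem_of_closed {k : ℕ} {P : Item → Prop}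
    (hbase : ∀ y : Item, y.lv = k →
      (y = ⟨0, 0, G.start, G.start⟩ ∨ ∃ x, G.Reaches x ∧ G.ErrSucc x y) → P y)
    (hclosed : ∀ x y, x.lv = k → P x → G.KeepSucc x y → P y) {y : Item} (hy : G.Reaches y)
    (hk : y.lv = k) : P y := by
  rcases y with ⟨i, c, p, q⟩
  change Reach G.tr G.start 0 (· + 1) i c p q at hy
  induction hy with
  | start => exact hbase _ hk (.inl rfl)
  | @keep i c p q a p' q' hr hp hq hc ih =>
    exact hclosed ⟨i, c, p, q⟩ _ hk (ih hk) ⟨a, p', q', hp, hq, hc, rfl⟩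
  | @sub i c p q a b p' q' hr hp hq hab hc _ =>
    exact hbase _ hk (.inr ⟨⟨i, c, p, q⟩, hr, .inl ⟨a, b, p', q', hp, hq, hab, hc, rfl⟩⟩)
  | @ins i c p q b q' hr hi hq hc _ =>
    exact hbase _ hk (.inr ⟨⟨i, c, p, q⟩, hr, .inr (.inl ⟨hi, b, q', hq, hc, rfl⟩)⟩)
  | @delFirst c p q a p' hr hp _ =>
    exact hbase _ hk (.inr ⟨⟨0, c, p, q⟩, hr, .inr (.inr ⟨a, p', hp, rfl⟩)⟩)
  | @del i c p q a p' hr hi hp _ =>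
    exact hbase _ hk (.inr ⟨⟨i, c, p, q⟩, hr, .inr (.inr ⟨a, p', hp, by simp [hi]⟩)⟩)

/-- The store holds the automaton. -/
structure Loaded (G : Graph) (s : Store) : Prop where
  n : s.reg .nQ = G.n
  r : s.reg .nS = G.r
  first : s.arr .first = G.first
  lab : s.arr .aLab = G.lab
  dst : s.arr .aDst = G.dst
  fin : s.arr .fin = G.fin

theorem Loaded.agree {X : List Reg} {s s' : Store} (h : G.Loaded s) (ha : Agree X s s')
    (hn : Reg.nQ ∉ X) (hr : Reg.nS ∉ X) : G.Loaded s' :=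
  ⟨(ha.reg _ hn).trans h.n, (ha.reg _ hr).trans h.r, (ha.arr _ (by simp [tableArrays])).trans h.first,
    (ha.arr _ (by simp [tableArrays])).trans h.lab, (ha.arr _ (by simp [tableArrays])).trans h.dst,
    (ha.arr _ (by simp [tableArrays])).trans h.fin⟩

end Graph

/-! ### Successors of a single product state -/

/-- The registers that change in the inner loops. -/
def innerRegs : List Reg := [.i, .i', .code, .cnt, .ecnt]

/-- The registers that change in the loops over product states. -/
def outerRegs : List Reg := [.j, .c, .p, .q, .i, .i', .code, .cnt, .ecnt]

section Levels

variable {G : Graph} {s : Store} {L : List Item} {x : Item}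

/-- The store holds the product state `x` in its registers. -/
structure Fetched (s : Store) (x : Item) : Prop where
  k : s.reg .k = x.lv
  c : s.reg .c = x.c
  p : s.reg .p = x.p
  q : s.reg .q = x.q

theorem Fetched.agree {X : List Reg} {s s' : Store} (h : Fetched s x) (ha : Agree X s s')
    (hX : ∀ y ∈ [Reg.k, .c, .p, .q], y ∉ X) : Fetched s' x := by
  simp only [List.mem_cons, List.not_mem_nil, or_false, forall_eq_or_imp, forall_eq] at hX
  exact ⟨(ha.reg _ hX.1).trans h.k, (ha.reg _ hX.2.1).trans h.c, (ha.reg _ hX.2.2.1).trans h.p,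
    (ha.reg _ hX.2.2.2).trans h.q⟩

/-- Evaluation of the pairs of transitions out of the two components of a product state. -/
theorem adds_forOut_forOut {body : Cmd} {B : ℕ → ℕ → Item → Prop} {T : ℕ} (hG : G.Loaded s)
    (hL : Tab G.n G.r s L) (hx : Fetched s x)
    (hbody : ∀ i i' s' L', G.first x.p ≤ i → i < G.first (x.p + 1) → G.first x.q ≤ i' →
      i' < G.first (x.q + 1) → G.Loaded s' → Fetched s' x → s'.reg .i = i → s'.reg .i' = i' →
      Tab G.n G.r s' L' → Adds G.n G.r countRegs body T s' L' (B i i')) :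
    Adds G.n G.r innerRegs (forOut .i .p (forOut .i' .q body))
      (G.deg x.p * G.deg x.q * (T + 60)) s L
      (fun y => ∃ i, G.first x.p ≤ i ∧ i < G.first (x.p + 1) ∧
        ∃ i', G.first x.q ≤ i' ∧ i' < G.first (x.q + 1) ∧ B i i' y) := by
  have h := adds_forOut (n := G.n) (r := G.r) (x := .i) (v := .p) (X := .i' :: countRegs) (s := s)
    (T := (G.deg x.q - 1) * (T + 20) + 20)
    (B := fun i y => ∃ i', G.first x.q ≤ i' ∧ i' < G.first (x.q + 1) ∧ B i i' y)
    (body := forOut .i' .q body) (by decide) (by decide) (by decide) hL ?_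
  · rw [hx.p, hG.first] at h
    refine h.congr ?_ fun y => Iff.rfl
    -- With out-degrees `e` of `x.p` and `d` of `x.q`, the cost is at most `e * (d * (T + 20) + 40)
    -- + 20`, which is below `(e + 1) * (d + 1) * (T + 60)`.
    obtain ⟨d, hd⟩ : ∃ d, G.deg x.q = d + 1 := ⟨_, rfl⟩
    rw [hd]
    unfold Graph.deg
    rw [Nat.add_sub_cancel]
    nlinarith [Nat.zero_le ((G.first (x.p + 1) - G.first x.p) * d), Nat.zero_le (d * T),
      Nat.zero_le ((G.first (x.p + 1) - G.first x.p) * T)]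
  · intro i s₁ L₁ hi hi' ha hsi hL₁
    rw [hx.p, hG.first] at hi hi'
    have hG₁ := hG.agree ha (by decide) (by decide)
    have hx₁ := hx.agree ha (by decide)
    have h := adds_forOut (n := G.n) (r := G.r) (x := .i') (v := .q) (X := countRegs) (s := s₁)
      (T := T) (B := B i) (body := body) (by decide) (by decide) (by decide) hL₁ ?_
    · rw [hx₁.q, hG₁.first] at h
      exact h.congr le_rfl fun y => Iff.rfl
    · intro i' s₂ L₂ hj hj' ha' hsi' hL₂
      rw [hx₁.q, hG₁.first] at hj hj'
      exact hbody i i' s₂ L₂ hi hi' hj hj' (hG₁.agree ha' (by decide) (by decide))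
        (hx₁.agree ha' (by decide)) (by rw [ha'.reg _ (by decide), hsi]) hsi' hL₂

/-- One test serves plain and tagged states: the kind `0` of a plain state never equals `a + 1`. -/
theorem adds_keepSucc (hW : G.Wf) (hG : G.Loaded s) (hL : Tab G.n G.r s L) (hx : Fetched s x)
    (hv : x.Valid G.n G.r) :
    Adds G.n G.r innerRegs (forOut .i .p (forOut .i' .q (
      .ite (.and (.eq (.get .aLab Reg.i) (.get .aLab Reg.i'))
          (.not (.eq (.get .aLab Reg.i' + 1) Reg.c)))
        (addTrans (.get .aLab Reg.i + 1) (.get .aLab Reg.i' + 1)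
          Reg.k 0 (.get .aDst Reg.i) (.get .aDst Reg.i'))
        .skip))) (G.deg x.p * G.deg x.q * 200) s L (G.KeepSucc x) := by
  -- 140 steps suffice for the test and one `addTrans`; the double loop adds 60.
  refine (adds_forOut_forOut (T := 140) (B := fun i i' y =>
    (G.lab i = G.lab i' ∧ G.lab i' + 1 ≠ x.c) ∧ y = ⟨x.lv, 0, G.dst i, G.dst i'⟩)
    hG hL hx ?_).congr le_rfl ?_
  · intro i i' s' L' h₁ h₂ h₃ h₄ hG' hx' hi hi' hL'
    refine (Adds.ite_skip hL' (B := (· = ⟨x.lv, 0, G.dst i, G.dst i'⟩)) ?_ fun h =>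
      adds_addTrans hG'.n hG'.r hL' ⟨Nat.zero_le _, hW.dst _ hv.2.1 _ h₁ h₂,
        hW.dst _ hv.2.2 _ h₃ h₄⟩ ?_).congr ?_ fun _ => Iff.rfl
    · simp [Test.eval, hi, hi', hG'.lab, hx'.c]
    · intro s'' ha
      simp [ha.reg .k (by decide), ha.reg .i (by decide), ha.reg .i' (by decide),
        ha.arr .aDst (by decide), hi, hi', hG'.dst, hx'.k]
    · simp [Test.cost]
  · intro y
    constructor
    · rintro ⟨i, h₁, h₂, i', h₃, h₄, ⟨h₅, h₆⟩, rfl⟩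
      exact ⟨_, _, _, ⟨i, h₁, h₂, rfl, rfl⟩, ⟨i', h₃, h₄, h₅.symm, rfl⟩, h₅ ▸ h₆, rfl⟩
    · rintro ⟨a, p, q, ⟨i, h₁, h₂, rfl, rfl⟩, ⟨i', h₃, h₄, h₅, rfl⟩, h₆, rfl⟩
      exact ⟨i, h₁, h₂, i', h₃, h₄, ⟨h₅.symm, h₅.symm ▸ h₆⟩, rfl⟩

theorem adds_subSucc (hW : G.Wf) (hG : G.Loaded s) (hL : Tab G.n G.r s L) (hx : Fetched s x)
    (hv : x.Valid G.n G.r) :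
    Adds G.n G.r innerRegs (forOut .i .p (forOut .i' .q (
      .ite (.and (.not (.eq (.get .aLab Reg.i) (.get .aLab Reg.i')))
          (.not (.eq (.get .aLab Reg.i' + 1) Reg.c)))
        (addTrans (.get .aLab Reg.i + 1) (.get .aLab Reg.i' + 1)
          (Reg.k + 1) 0 (.get .aDst Reg.i) (.get .aDst Reg.i'))
        .skip))) (G.deg x.p * G.deg x.q * 200) s L (G.SubSucc x) := by
  refine (adds_forOut_forOut (T := 140) (B := fun i i' y =>
    (G.lab i ≠ G.lab i' ∧ G.lab i' + 1 ≠ x.c) ∧ y = ⟨x.lv + 1, 0, G.dst i, G.dst i'⟩)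
    hG hL hx ?_).congr le_rfl ?_
  · intro i i' s' L' h₁ h₂ h₃ h₄ hG' hx' hi hi' hL'
    refine (Adds.ite_skip hL' (B := (· = ⟨x.lv + 1, 0, G.dst i, G.dst i'⟩)) ?_ fun h =>
      adds_addTrans hG'.n hG'.r hL' ⟨Nat.zero_le _, hW.dst _ hv.2.1 _ h₁ h₂,
        hW.dst _ hv.2.2 _ h₃ h₄⟩ ?_).congr ?_ fun _ => Iff.rfl
    · simp [Test.eval, hi, hi', hG'.lab, hx'.c]
    · intro s'' ha
      simp [ha.reg .k (by decide), ha.reg .i (by decide), ha.reg .i' (by decide),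
        ha.arr .aDst (by decide), hi, hi', hG'.dst, hx'.k]
    · simp [Test.cost]
  · intro y
    constructor
    · rintro ⟨i, h₁, h₂, i', h₃, h₄, ⟨h₅, h₆⟩, rfl⟩
      exact ⟨_, _, _, _, ⟨i, h₁, h₂, rfl, rfl⟩, ⟨i', h₃, h₄, rfl, rfl⟩, h₅, h₆, rfl⟩
    · rintro ⟨a, b, p, q, ⟨i, h₁, h₂, rfl, rfl⟩, ⟨i', h₃, h₄, rfl, rfl⟩, h₅, h₆, rfl⟩
      exact ⟨i, h₁, h₂, i', h₃, h₄, ⟨h₅, h₆⟩, rfl⟩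

theorem adds_insSucc (hW : G.Wf) (hG : G.Loaded s) (hL : Tab G.n G.r s L) (hx : Fetched s x)
    (hv : x.Valid G.n G.r) :
    Adds G.n G.r innerRegs (forOut .i' .q
        (.ite (.not (.eq (.get .aLab Reg.i' + 1) Reg.c))
          (addTrans 0 (.get .aLab Reg.i' + 1) (Reg.k + 1) 0 Reg.p (.get .aDst Reg.i'))
          .skip)) (G.deg x.q * 200) s L (G.InsSucc x) := by
  have h := adds_forOut (n := G.n) (r := G.r) (x := .i') (v := .q) (X := countRegs) (s := s)
    (T := 140) (B := fun i' y => G.lab i' + 1 ≠ x.c ∧ y = ⟨x.lv + 1, 0, x.p, G.dst i'⟩)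
    (body := .ite (.not (.eq (.get .aLab Reg.i' + 1) Reg.c))
          (addTrans 0 (.get .aLab Reg.i' + 1) (Reg.k + 1) 0 Reg.p (.get .aDst Reg.i'))
          .skip) (by decide) (by decide) (by decide) hL ?_
  · rw [hx.q, hG.first] at h
    refine (h.mono_regs (by decide)).congr ?_ fun y => ?_
    · unfold Graph.deg
      omega
    · constructor
      · rintro ⟨i', h₃, h₄, h₅, rfl⟩
        exact ⟨_, _, ⟨i', h₃, h₄, rfl, rfl⟩, h₅, rfl⟩
      · rintro ⟨b, q, ⟨i', h₃, h₄, rfl, rfl⟩, h₅, rfl⟩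
        exact ⟨i', h₃, h₄, h₅, rfl⟩
  · intro i' s' L' h₃ h₄ ha hi' hL'
    rw [hx.q, hG.first] at h₃ h₄
    have hG' := hG.agree ha (by decide) (by decide)
    have hx' := hx.agree ha (by decide)
    refine (Adds.ite_skip hL' (B := (· = ⟨x.lv + 1, 0, x.p, G.dst i'⟩)) ?_ fun h =>
      adds_addTrans hG'.n hG'.r hL' ⟨Nat.zero_le _, hv.2.1, hW.dst _ hv.2.2 _ h₃ h₄⟩ ?_).congr ?_
        fun _ => Iff.rfl
    · simp [Test.eval, hi', hG'.lab, hx'.c]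
    · intro s'' ha
      simp [ha.reg .k (by decide), ha.reg .p (by decide), ha.reg .i' (by decide),
        ha.arr .aDst (by decide), hi', hG'.dst, hx'.k, hx'.p]
    · simp [Test.cost]

/-- The expression `e` is all that distinguishes the first deletion, which creates a tag, from later
ones, which keep the kind. -/
theorem adds_delSucc {e : Expr} (hW : G.Wf) (hG : G.Loaded s) (hL : Tab G.n G.r s L)
    (hx : Fetched s x) (hv : x.Valid G.n G.r) (he : e.cost ≤ 10)
    (he' : e = if x.lv = 0 then .get .aLab Reg.i + 1 else .reg .c) :
    Adds G.n G.r innerRegs (forOut .i .p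
        (addTrans (.get .aLab Reg.i + 1) 0 (Reg.k + 1) e (.get .aDst Reg.i) Reg.q))
      (G.deg x.p * 200) s L (G.DelSucc x) := by
  have h := adds_forOut (n := G.n) (r := G.r) (x := .i) (v := .p) (X := countRegs) (s := s)
    (T := 140) (B := fun i y =>
      y = ⟨x.lv + 1, if x.lv = 0 then G.lab i + 1 else x.c, G.dst i, x.q⟩)
    (body := addTrans (.get .aLab Reg.i + 1) 0 (Reg.k + 1) e (.get .aDst Reg.i) Reg.q)
    (by decide) (by decide) (by decide) hL ?_
  · rw [hx.p, hG.first] at h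
    refine (h.mono_regs (by decide)).congr ?_ fun y => ?_
    · unfold Graph.deg
      omega
    · constructor
      · rintro ⟨i, h₁, h₂, rfl⟩
        exact ⟨_, _, ⟨i, h₁, h₂, rfl, rfl⟩, rfl⟩
      · rintro ⟨b, q, ⟨i, h₁, h₂, rfl, rfl⟩, rfl⟩
        exact ⟨i, h₁, h₂, rfl⟩
  · intro i s' L' h₁ h₂ ha hi hL'
    rw [hx.p, hG.first] at h₁ h₂
    have hG' := hG.agree ha (by decide) (by decide)
    have hx' := hx.agree ha (by decide)
    refine (adds_addTrans (x := ⟨x.lv + 1, if x.lv = 0 then G.lab i + 1 else x.c, G.dst i, x.q⟩)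
      hG'.n hG'.r hL' ⟨?_, hW.dst _ hv.2.1 _ h₁ h₂, hv.2.2⟩ ?_).congr ?_
        fun _ => Iff.rfl
    · dsimp only
      split_ifs
      exacts [hW.lab _ hv.2.1 _ h₁ h₂, hv.1]
    · intro s'' ha
      subst he'
      split_ifs <;>
      simp [ha.reg .k (by decide), ha.reg .q (by decide), ha.reg .i (by decide),
        ha.reg .c (by decide), ha.arr .aDst (by decide), ha.arr .aLab (by decide), hi,
        hG'.dst, hG'.lab, hx'.k, hx'.q, hx'.c]
    · simp
      omega

/-- Substitutions take 200 of the 700 units. The single loops for insertions and deletions are also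
charged to `deg p * deg q`, as both factors are at least `1`. -/
theorem adds_errSucc (hW : G.Wf) (hG : G.Loaded s) (hL : Tab G.n G.r s L) (hx : Fetched s x)
    (hv : x.Valid G.n G.r) :
    Adds G.n G.r innerRegs (forOut .i .p (forOut .i' .q (
      .ite (.and (.not (.eq (.get .aLab Reg.i) (.get .aLab Reg.i')))
          (.not (.eq (.get .aLab Reg.i' + 1) Reg.c)))
        (addTrans (.get .aLab Reg.i + 1) (.get .aLab Reg.i' + 1)
          (Reg.k + 1) 0 (.get .aDst Reg.i) (.get .aDst Reg.i'))
        .skip)) ;;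
    .ite (.eq Reg.k 0)
      (forOut .i .p
        (addTrans (.get .aLab Reg.i + 1) 0
          (Reg.k + 1) (.get .aLab Reg.i + 1) (.get .aDst Reg.i) Reg.q))
      (forOut .i' .q
        (.ite (.not (.eq (.get .aLab Reg.i' + 1) Reg.c))
          (addTrans 0 (.get .aLab Reg.i' + 1) (Reg.k + 1) 0 Reg.p (.get .aDst Reg.i'))
          .skip) ;;
      forOut .i .p
        (addTrans (.get .aLab Reg.i + 1) 0
          (Reg.k + 1) Reg.c (.get .aDst Reg.i) Reg.q)))
      (G.deg x.p * G.deg x.q * 700) s L (G.ErrSucc x) := by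
  have hp : 1 ≤ G.deg x.p := Nat.le_add_left _ _
  have hq : 1 ≤ G.deg x.q := Nat.le_add_left _ _
  refine ((adds_subSucc hW hG hL hx hv).seq
    (T' := G.deg x.p * G.deg x.q * 500)
    (B' := fun y => (x.lv ≠ 0 ∧ G.InsSucc x y) ∨ G.DelSucc x y) ?_).congr ?_ fun _ => Iff.rfl
  · intro s' L' ha hL'
    have hG' := hG.agree ha (by decide) (by decide)
    have hx' := hx.agree ha (by decide)
    by_cases h0 : x.lv = 0
    · refine (wp_ite_true ?_).2
        ((adds_delSucc hW hG' hL' hx' hv (by simp) (by simp [h0])).mono ?_)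
      · simp [Test.eval, hx'.k, h0]
      · rintro t s'' ⟨ht, ha, L'', h₁, h₂⟩
        refine ⟨?_, ha, L'', h₁, h₂.congr (by simp [h0])⟩
        simp only [Test.cost, Expr.cost_reg, Expr.cost_zero]
        nlinarith
    · refine (wp_ite_false ?_).2
        (((adds_insSucc hW hG' hL' hx' hv).seq fun s₂ L₂ ha₂ hL₂ =>
          adds_delSucc hW (hG'.agree ha₂ (by decide) (by decide)) hL₂ (hx'.agree ha₂ (by decide)) hv
            (by simp) (by simp [h0])).mono ?_)
      · simp [Test.eval, hx'.k, h0]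
      · rintro t s'' ⟨ht, ha, L'', h₁, h₂⟩
        refine ⟨?_, ha, L'', h₁, h₂.congr (by simp [h0])⟩
        simp only [Test.cost, Expr.cost_reg, Expr.cost_zero]
        nlinarith
  · omega

/-- Fetching the next product state. -/
theorem wp_next {rest : Cmd} {post : ℕ → Store → Prop} {n r j : ℕ} (hL : Tab n r s L)
    (hj : s.reg .j = j) (hx : L[j]? = some x) (hk : s.reg .k = x.lv)
    (h : ∀ s', Agree [.j, .c, .p, .q] s s' → Tab n r s' L → s'.reg .j = j + 1 → Fetched s' x →
      Wp rest s' fun t s'' => post (4 + (9 + t)) s'') :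
    Wp (.j ≔ Reg.j + 1 ;; fetch ;; rest) s post := by
  unfold fetch
  simp only [wp_seq, wp_set]
  obtain ⟨h₁, h₂, h₃⟩ := hL.row _ _ hx
  refine h _ ?_ ?_ ?_ ⟨?_, ?_, ?_, ?_⟩
  · exact ((((Agree.refl _ s).setReg (by simp)).setReg (by simp)).setReg (by simp)).setReg (by simp)
  · exact (((hL.setReg (by simp)).setReg (by simp)).setReg (by simp)).setReg (by simp)
  all_goals simp [hj, hk, h₁, h₂, h₃]

end Levels

/-! ### Counting product states of one level -/

namespace Graph

/-- The number of pairs of a product state of some fixed level, up to the kind, and of a pair of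
transitions or empty moves out of its components, times the number of kinds. -/
def levelSize (G : Graph) : ℕ := (G.r + 1) * (∑ p ∈ Finset.range G.n, G.deg p) ^ 2

theorem one_le_deg (G : Graph) (p : ℕ) : 1 ≤ G.deg p := Nat.le_add_left _ _

/-- On one level a state is determined by its kind and components, so the sum is at most that over
all triples, and there the sum of products factors. -/
theorem sum_le_levelSize (G : Graph) {k : ℕ} {l : List Item} (hl : l.Nodup)
    (hv : ∀ x ∈ l, x.lv = k ∧ x.Valid G.n G.r) :
    (l.map fun x => G.deg x.p * G.deg x.q).sum ≤ G.levelSize := by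
  classical
  rw [← List.sum_toFinset _ hl]
  have hinj : Set.InjOn (fun x : Item => (x.c, x.p, x.q)) (l.toFinset : Set Item) := by
    intro x hx y hy h
    rw [Finset.mem_coe, List.mem_toFinset] at hx hy
    simp only [Prod.mk.injEq] at h
    exact Item.ext ((hv x hx).1.trans (hv y hy).1.symm) h.1 h.2.1 h.2.2
  calc ∑ x ∈ l.toFinset, G.deg x.p * G.deg x.q
      = ∑ z ∈ l.toFinset.image fun x : Item => (x.c, x.p, x.q), G.deg z.2.1 * G.deg z.2.2 :=
        (Finset.sum_image (f := fun z : ℕ × ℕ × ℕ => G.deg z.2.1 * G.deg z.2.2) hinj).symm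
    _ ≤ ∑ z ∈ Finset.range (G.r + 1) ×ˢ (Finset.range G.n ×ˢ Finset.range G.n),
          G.deg z.2.1 * G.deg z.2.2 := by
        refine Finset.sum_le_sum_of_subset fun z hz => ?_
        obtain ⟨x, hx, rfl⟩ := Finset.mem_image.1 hz
        obtain ⟨-, h₁, h₂, h₃⟩ := hv x (List.mem_toFinset.1 hx)
        simp [h₂, h₃]
        omega
    _ = G.levelSize := by
        simp only [Finset.sum_product, Finset.sum_const, Finset.card_range, levelSize, sq,
          Finset.sum_mul_sum, smul_eq_mul]

theorem length_le_sum (G : Graph) (l : List Item) :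
    l.length ≤ (l.map fun x => G.deg x.p * G.deg x.q).sum := by
  induction l with
  | nil => simp
  | cons x l ih =>
    rw [List.map_cons, List.sum_cons, List.length_cons]
    have := Nat.mul_le_mul (G.one_le_deg x.p) (G.one_le_deg x.q)
    omega

theorem length_le_levelSize (G : Graph) {k : ℕ} {l : List Item} (hl : l.Nodup)
    (hv : ∀ x ∈ l, x.lv = k ∧ x.Valid G.n G.r) : l.length ≤ G.levelSize :=
  (G.length_le_sum l).trans (G.sum_le_levelSize hl hv)

/-- Allows constant overheads to be absorbed into multiples of `levelSize`. -/
theorem Wf.one_le_levelSize {G : Graph} (hW : G.Wf) : 1 ≤ G.levelSize := by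
  have h₁ := Finset.single_le_sum (fun i _ => Nat.zero_le (G.deg i))
    (Finset.mem_range.2 hW.start)
  exact Nat.mul_pos (Nat.succ_pos _) (Nat.pow_pos ((G.one_le_deg G.start).trans h₁))

end Graph

/-! ### From one level to the next -/

section Levels

variable {G : Graph} {s : Store} {L L₀ L₁ : List Item} {k : ℕ}

theorem sum_map_drop {l : List Item} {i : ℕ} {x : Item} (h : l[i]? = some x) (f : Item → ℕ) :
    ((l.drop i).map f).sum = f x + ((l.drop (i + 1)).map f).sum := by
  obtain ⟨hi, rfl⟩ := List.getElem?_eq_some_iff.1 h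
  rw [List.drop_eq_getElem_cons hi, List.map_cons, List.sum_cons]

theorem mem_drop_iff {l : List Item} {i : ℕ} {x y : Item} (h : l[i]? = some x) :
    y ∈ l.drop i ↔ y = x ∨ y ∈ l.drop (i + 1) := by
  obtain ⟨hi, rfl⟩ := List.getElem?_eq_some_iff.1 h
  rw [List.drop_eq_getElem_cons hi, List.mem_cons]

/-- One pass over product states with numbers after `lo`, up to a fixed number. -/
theorem adds_rows {body : Cmd} {B : Item → Item → Prop} {T : ℕ} (hG : G.Loaded s)
    (hbody : ∀ x s' L', x ∈ L₁ → G.Loaded s' → Fetched s' x → Tab G.n G.r s' L' →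
      Adds G.n G.r innerRegs body (G.deg x.p * G.deg x.q * T) s' L' (B x))
    (hk : ∀ x ∈ L₁, x.lv = s.reg .k) (hhi : s.reg .hi = (L₀ ++ L₁).length) :
    ∀ (N i : ℕ) (s' : Store), L₁.length - i = N → i ≤ L₁.length → Agree outerRegs s s' →
      s'.reg .j = L₀.length + i → ∀ L', Tab G.n G.r s' L' → L₀ ++ L₁ <+: L' →
      Adds G.n G.r outerRegs (.loop (.lt Reg.j Reg.hi) (.j ≔ Reg.j + 1 ;; fetch ;; body))
        (((L₁.drop i).map fun x => G.deg x.p * G.deg x.q).sum * (T + 20) + 5) s' L'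
        (fun y => ∃ x ∈ L₁.drop i, B x y) := by
  intro N
  induction N with
  | zero =>
    intro i s' hN hi ha hj L' hL' hp
    refine Wp.loop_false ?_ ⟨by simp [Test.cost], .refl _ _, L', hL', (Ext.refl _).congr ?_⟩
    · simp [Test.eval, hj, ha.reg .hi (by decide), hhi]
      omega
    · intro y
      rw [List.drop_eq_nil_of_le (by omega)]
      simp
  | succ N ih =>
    intro i s' hN hi ha hj L' hL' hp
    obtain ⟨x, hx⟩ : ∃ x, L₁[i]? = some x := ⟨_, List.getElem?_eq_getElem (by omega)⟩
    have hxm : x ∈ L₁ := List.mem_of_getElem? hx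
    -- Rows are only appended, so the old rows keep their numbers during the pass.
    have hx' : L'[L₀.length + i]? = some x := by
      obtain ⟨L'', rfl⟩ := hp
      rw [List.append_assoc, List.getElem?_append_right (by omega), Nat.add_sub_cancel_left,
        List.getElem?_append_left (by omega), hx]
    refine Wp.loop_true ?_ (wp_next hL' hj hx' ?_ ?_)
    · simp [Test.eval, hj, ha.reg .hi (by decide), hhi]
      omega
    · rw [ha.reg .k (by decide), hk x hxm]
    · intro s₁ ha₁ hL₁ hj₁ hF₁
      have ha₁' : Agree outerRegs s' s₁ := ha₁.mono (by decide)
      refine (hbody x s₁ L' hxm (hG.agree (ha.trans ha₁') (by decide) (by decide)) hF₁ hL₁).mono ?_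
      rintro t s₂ ⟨ht, ha₂, L₂, hL₂, hE₂⟩
      have ha₂' : Agree outerRegs s' s₂ := ha₁'.trans (ha₂.mono (by decide))
      refine (ih (i + 1) s₂ (by omega) (by omega) (ha.trans ha₂')
        (by rw [ha₂.reg .j (by decide), hj₁, add_assoc]) L₂ hL₂ (hp.trans hE₂.isPrefix)).mono ?_
      rintro t' s₃ ⟨ht', ha₃, L₃, hL₃, hE₃⟩
      refine ⟨?_, ha₂'.trans ha₃, L₃, hL₃, (hE₂.trans hE₃).congr fun y => ?_⟩
      · rw [sum_map_drop hx, Nat.add_mul, Nat.mul_add]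
        have := Nat.mul_le_mul (G.one_le_deg x.p) (G.one_le_deg x.q)
        simp [Test.cost, -List.map_drop]
        omega
      · simp [mem_drop_iff hx]

/-- `extend` with its first two assignments and its loop over product states written out. -/
theorem extend_eq : extend =
    (.hi ≔ Reg.cnt ;; .j ≔ Reg.lo ;;
    .loop (.lt Reg.j Reg.hi) (.j ≔ Reg.j + 1 ;; fetch ;;
    forOut .i .p (forOut .i' .q (
      .ite (.and (.not (.eq (.get .aLab Reg.i) (.get .aLab Reg.i')))
          (.not (.eq (.get .aLab Reg.i' + 1) Reg.c)))
        (addTrans (.get .aLab Reg.i + 1) (.get .aLab Reg.i' + 1)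
          (Reg.k + 1) 0 (.get .aDst Reg.i) (.get .aDst Reg.i'))
        .skip)) ;;
    .ite (.eq Reg.k 0)
      (forOut .i .p
        (addTrans (.get .aLab Reg.i + 1) 0
          (Reg.k + 1) (.get .aLab Reg.i + 1) (.get .aDst Reg.i) Reg.q))
      (forOut .i' .q
        (.ite (.not (.eq (.get .aLab Reg.i' + 1) Reg.c))
          (addTrans 0 (.get .aLab Reg.i' + 1) (Reg.k + 1) 0 Reg.p (.get .aDst Reg.i'))
          .skip) ;;
      forOut .i .p
        (addTrans (.get .aLab Reg.i + 1) 0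
          (Reg.k + 1) Reg.c (.get .aDst Reg.i) Reg.q))) ;;
  .lo ≔ Reg.hi ;; .k ≔ Reg.k + 1 ;; close) := rfl

/-- The worklist loop of `close`. -/
theorem wp_close_loop {body : Cmd} {T : ℕ} (hG : G.Loaded s)
    (hbody : ∀ x s' L', x.Valid G.n G.r → G.Loaded s' → Fetched s' x → Tab G.n G.r s' L' →
      Adds G.n G.r innerRegs body (G.deg x.p * G.deg x.q * T) s' L' (G.KeepSucc x)) :
    ∀ (N i : ℕ) (s' : Store), G.levelSize - i = N → Agree outerRegs s s' →
      s'.reg .j = L₀.length + i → ∀ L₁, i ≤ L₁.length → Tab G.n G.r s' (L₀ ++ L₁) →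
      (∀ x ∈ L₁, x.lv = s.reg .k ∧ G.Reaches x) →
      Wp (.loop (.lt Reg.j Reg.cnt) (.j ≔ Reg.j + 1 ;; fetch ;; body)) s' fun t s'' =>
        Agree outerRegs s' s'' ∧ ∃ L₁', L₁ <+: L₁' ∧ Tab G.n G.r s'' (L₀ ++ L₁') ∧
          (∀ x ∈ L₁', x.lv = s.reg .k ∧ G.Reaches x) ∧
          (∀ x ∈ L₁'.drop i, ∀ y, G.KeepSucc x y → y ∈ L₀ ++ L₁') ∧
          t ≤ ((L₁'.drop i).map fun x => G.deg x.p * G.deg x.q).sum * (T + 20) + 5 := by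
  -- Rows of one level are distinct, so the worklist cannot outgrow `levelSize`; this bounds the
  -- number of rounds.
  have hlen : ∀ {s' L₁}, Tab G.n G.r s' (L₀ ++ L₁) →
      (∀ x ∈ L₁, x.lv = s.reg .k ∧ G.Reaches x) → L₁.length ≤ G.levelSize :=
    fun h h' => G.length_le_levelSize (List.nodup_append.1 h.nodup).2.1
      fun x hx => ⟨(h' x hx).1, h.valid x (List.mem_append_right _ hx)⟩
  have done : ∀ (i : ℕ) (s' : Store), s'.reg .j = L₀.length + i → ∀ L₁, i = L₁.length →
      Tab G.n G.r s' (L₀ ++ L₁) → (∀ x ∈ L₁, x.lv = s.reg .k ∧ G.Reaches x) →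
      Wp (.loop (.lt Reg.j Reg.cnt) (.j ≔ Reg.j + 1 ;; fetch ;; body)) s' fun t s'' =>
        Agree outerRegs s' s'' ∧ ∃ L₁', L₁ <+: L₁' ∧ Tab G.n G.r s'' (L₀ ++ L₁') ∧
          (∀ x ∈ L₁', x.lv = s.reg .k ∧ G.Reaches x) ∧
          (∀ x ∈ L₁'.drop i, ∀ y, G.KeepSucc x y → y ∈ L₀ ++ L₁') ∧
          t ≤ ((L₁'.drop i).map fun x => G.deg x.p * G.deg x.q).sum * (T + 20) + 5 := by
    intro i s' hj L₁ hi hL hR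
    refine Wp.loop_false ?_ ⟨.refl _ _, L₁, List.prefix_rfl, hL, hR, ?_, by simp [Test.cost]⟩
    · simp [Test.eval, hj, hL.cnt, hi]
    · simp [hi]
  intro N
  induction N with
  | zero =>
    intro i s' hN ha hj L₁ hi hL hR
    -- Here `levelSize ≤ i ≤ L₁.length ≤ levelSize`, so every row has been processed.
    exact done i s' hj L₁ (by have := hlen hL hR; omega) hL hR
  | succ N ih =>
    intro i s' hN ha hj L₁ hi hL hR
    rcases Nat.eq_or_lt_of_le hi with hi | hi
    · exact done i s' hj L₁ hi hL hR
    obtain ⟨x, hx⟩ : ∃ x, L₁[i]? = some x := ⟨_, List.getElem?_eq_getElem hi⟩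
    have hxm : x ∈ L₁ := List.mem_of_getElem? hx
    have hx' : (L₀ ++ L₁)[L₀.length + i]? = some x := by
      rw [List.getElem?_append_right (by omega), Nat.add_sub_cancel_left, hx]
    refine Wp.loop_true ?_ (wp_next hL hj hx' ?_ ?_)
    · simp [Test.eval, hj, hL.cnt]
      omega
    · rw [ha.reg .k (by decide), (hR x hxm).1]
    · intro s₁ ha₁ hL₁ hj₁ hF₁
      have ha₁' : Agree outerRegs s' s₁ := ha₁.mono (by decide)
      refine (hbody x s₁ _ (hL.valid x (List.mem_append_right _ hxm))
        (hG.agree (ha.trans ha₁') (by decide) (by decide)) hF₁ hL₁).mono ?_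
      rintro t s₂ ⟨ht, ha₂, L₂, hL₂, hE₂⟩
      obtain ⟨E, rfl⟩ := hE₂.isPrefix
      rw [List.append_assoc] at hL₂ hE₂
      have hm := hE₂.mem_iff
      have ha₂' : Agree outerRegs s' s₂ := ha₁'.trans (ha₂.mono (by decide))
      refine (ih (i + 1) s₂ (by omega) (ha.trans ha₂')
        (by rw [ha₂.reg .j (by decide), hj₁, add_assoc]) (L₁ ++ E) (by simp; omega) hL₂ ?_).mono ?_
      · intro y hy
        rw [List.mem_append] at hy
        rcases hy with hy | hy
        · exact hR y hy
        · rcases (hm y).1 (by simp [hy]) with h | h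
          -- By distinctness an appended row is not an old one, so it is a successor of `x`.
          · have hd := hL₂.nodup
            rw [← List.append_assoc] at hd
            exact absurd rfl ((List.nodup_append.1 hd).2.2 y h y hy)
          · refine ⟨?_, h.reaches (hR x hxm).2⟩
            obtain ⟨a, p, q, -, -, -, rfl⟩ := h
            exact (hR x hxm).1
      · rintro t' s₃ ⟨ha₃, L₃, hpre, hL₃, hR₃, hc₃, ht'⟩
        have hpre' : L₁ <+: L₃ := (List.prefix_append _ _).trans hpre
        have hx₃ : L₃[i]? = some x := by
          obtain ⟨F, rfl⟩ := hpre'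
          rw [List.getElem?_append_left hi, hx]
        refine ⟨ha₂'.trans ha₃, L₃, hpre', hL₃, hR₃, ?_, ?_⟩
        · intro z hz y hzy
          rcases (mem_drop_iff hx₃).1 hz with rfl | hz
          -- The successors of `x` are in the tables after its own round and stay there.
          · have := (hm y).2 (.inr hzy)
            rw [List.mem_append] at this ⊢
            exact this.imp_right fun h => hpre.subset h
          · exact hc₃ z hz y hzy
        · rw [sum_map_drop hx₃, Nat.add_mul]
          have := Nat.mul_le_mul (G.one_le_deg x.p) (G.one_le_deg x.q)
          rw [Nat.mul_add (G.deg x.p * G.deg x.q)]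
          simp [Test.cost, -List.map_drop]
          omega

/-- The tables hold the accessible product states of counter at most `k`; those of counter `k` are
the rows after `lo`. -/
structure AtLevel (G : Graph) (k : ℕ) (s : Store) (L₀ L₁ : List Item) : Prop where
  loaded : G.Loaded s
  tab : Tab G.n G.r s (L₀ ++ L₁)
  counter : s.reg .k = k
  lo : s.reg .lo = L₀.length
  lt : ∀ x ∈ L₀, x.lv < k
  mem : ∀ x, x ∈ L₁ ↔ x.lv = k ∧ G.Reaches x

/-- `L₁` starts with the base of level `k` and ends closed under `KeepSucc`, so
`Graph.Reaches.mem_of_closed` yields the whole level. The factor 220 is 200 for the successors plus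
20 for the loop. -/
theorem wp_close (hW : G.Wf) (hG : G.Loaded s) (hL : Tab G.n G.r s (L₀ ++ L₁))
    (hk : s.reg .k = k) (hlo : s.reg .lo = L₀.length) (hlt : ∀ x ∈ L₀, x.lv < k)
    (hR : ∀ x ∈ L₁, x.lv = k ∧ G.Reaches x)
    (hbase : ∀ y : Item, y.lv = k →
      (y = ⟨0, 0, G.start, G.start⟩ ∨ ∃ x, G.Reaches x ∧ G.ErrSucc x y) → y ∈ L₁) :
    Wp close s fun t s' => t ≤ G.levelSize * 220 + 10 ∧ ∃ L₁', AtLevel G k s' L₀ L₁' := by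
  unfold close
  rw [wp_seq, wp_set]
  set s₁ := s.setReg .j (Expr.eval s Reg.lo) with hs₁
  have ha₁ : Agree outerRegs s s₁ := (Agree.refl _ s).setReg (by decide)
  have hL₁ : Tab G.n G.r s₁ (L₀ ++ L₁) := hL.setReg (by decide)
  refine (wp_close_loop hG (fun x s' L' hv hG' hF hL' => adds_keepSucc hW hG' hL' hF hv)
    _ 0 s₁ rfl ha₁ (by simp [hs₁, hlo]) L₁ (Nat.zero_le _) hL₁ (by rwa [hk])).mono ?_
  rintro t s₂ ⟨ha₂, L₂, hpre, hL₂, hR₂, hc₂, ht⟩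
  have ha₂' := ha₁.trans ha₂
  rw [hk] at hR₂
  rw [List.drop_zero] at hc₂ ht
  refine ⟨?_, L₂, hG.agree ha₂' (by decide) (by decide), hL₂, (ha₂'.reg _ (by decide)).trans hk,
    (ha₂'.reg _ (by decide)).trans hlo, hlt, fun x => ⟨hR₂ x, ?_⟩⟩
  · have := G.sum_le_levelSize (List.nodup_append.1 hL₂.nodup).2.1
      fun x hx => ⟨(hR₂ x hx).1, hL₂.valid x (List.mem_append_right _ hx)⟩
    have := Nat.mul_le_mul_right 220 this
    simp
    omega
  · rintro ⟨hxk, hx⟩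
    refine hx.mem_of_closed (P := (· ∈ L₂)) (fun y hy h => hpre.subset (hbase y hy h)) ?_ hxk
    intro y z hy hyL hyz
    rcases List.mem_append.1 (hc₂ y hyL z hyz) with h | h
    -- `KeepSucc` preserves the counter, so its successors are not among the lower levels.
    · have := hlt z h
      obtain ⟨a, p, q, -, -, -, rfl⟩ := hyz
      simp at this
      omega
    · exact h

/-- The pass over level `k` yields the base that `close` completes to level `k + 1`. It costs 720
units and the closure 220; the rest of the 1000 absorbs constants. -/
theorem wp_extend (hW : G.Wf) (h : AtLevel G k s L₀ L₁) :
    Wp extend s fun t s' => t ≤ G.levelSize * 1000 ∧ ∃ L₂, AtLevel G (k + 1) s' (L₀ ++ L₁) L₂ := by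
  rw [extend_eq]
  simp only [wp_seq, wp_set]
  set s₁ := (s.setReg .hi (Expr.eval s Reg.cnt)).setReg .j
    (Expr.eval (s.setReg .hi (Expr.eval s Reg.cnt)) Reg.lo) with hs₁
  have ha₁ : Agree [.hi, .j] s s₁ := ((Agree.refl _ s).setReg (by decide)).setReg (by decide)
  have hL₁ : Tab G.n G.r s₁ (L₀ ++ L₁) := (h.tab.setReg (by decide)).setReg (by decide)
  have hG₁ := h.loaded.agree ha₁ (by decide) (by decide)
  have hk₁ : s₁.reg .k = k := (ha₁.reg _ (by decide)).trans h.counter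
  have hhi₁ : s₁.reg .hi = (L₀ ++ L₁).length := by simp [hs₁, h.tab.cnt]
  have hpos := hW.one_le_levelSize
  refine (adds_rows (L₀ := L₀) (L₁ := L₁) hG₁ (fun x s' L' hx hG' hF hL' =>
    adds_errSucc hW hG' hL' hF (h.tab.valid x (List.mem_append_right _ hx)))
    (fun x hx => by rw [hk₁, ((h.mem x).1 hx).1]) hhi₁ _ 0 s₁ rfl (Nat.zero_le _) (.refl _ _)
    (by simp [hs₁, h.lo]) _ hL₁ List.prefix_rfl).mono ?_
  rintro t s₂ ⟨ht, ha₂, L', hL', hE⟩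
  obtain ⟨N, rfl⟩ := hE.isPrefix
  rw [List.drop_zero] at ht hE
  set s₃ := (s₂.setReg .lo (Expr.eval s₂ Reg.hi)).setReg .k
    (Expr.eval (s₂.setReg .lo (Expr.eval s₂ Reg.hi)) (Reg.k + 1)) with hs₃
  have hG₂ := hG₁.agree ha₂ (by decide) (by decide)
  have ha₃ : Agree [.lo, .k] s₂ s₃ := ((Agree.refl _ s₂).setReg (by decide)).setReg (by decide)
  have hL₃ : Tab G.n G.r s₃ (L₀ ++ L₁ ++ N) := (hL'.setReg (by decide)).setReg (by decide)
  have hlt : ∀ x ∈ L₀ ++ L₁, x.lv < k + 1 := by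
    intro x hx
    rcases List.mem_append.1 hx with hx | hx
    · have := h.lt x hx
      omega
    · have := ((h.mem x).1 hx).1
      omega
  -- Error successors have counter `k + 1` and old rows at most `k`, so none of them was present
  -- before.
  have hN : ∀ y, y ∈ N ↔ ∃ x ∈ L₁, G.ErrSucc x y := by
    intro y
    constructor
    · intro hy
      rcases (hE.mem_iff y).1 (List.mem_append_right _ hy) with h' | h'
      · exact absurd rfl ((List.nodup_append.1 hL'.nodup).2.2 y h' y hy)
      · exact h'
    · rintro ⟨x, hx, hxy⟩
      rcases List.mem_append.1 ((hE.mem_iff y).2 (.inr ⟨x, hx, hxy⟩)) with h' | h'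
      · have h₁ := hlt y h'
        have h₂ := ((h.mem x).1 hx).1
        rw [hxy.lv] at h₁
        omega
      · exact h'
  refine (wp_close (k := k + 1) hW (hG₂.agree ha₃ (by decide) (by decide)) hL₃
    (by simp [hs₃, ha₂.reg .k (by decide), hk₁])
    (by simpa [hs₃, ha₂.reg .hi (by decide)] using hhi₁) hlt ?_ ?_).mono ?_
  · intro y hy
    obtain ⟨x, hx, hxy⟩ := (hN y).1 hy
    obtain ⟨h₁, h₂⟩ := (h.mem x).1 hx
    exact ⟨by rw [hxy.lv, h₁], hxy.reaches h₂⟩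
  · rintro y hy (rfl | ⟨x, hx, hxy⟩)
    · exact absurd hy.symm (Nat.succ_ne_zero k)
    · refine (hN y).2 ⟨x, (h.mem x).2 ⟨?_, hx⟩, hxy⟩
      have := hxy.lv
      omega
  · rintro t' s₄ ⟨ht', L₂, h₂⟩
    refine ⟨?_, L₂, h₂⟩
    have := Nat.mul_le_mul_right 720 <| G.sum_le_levelSize (List.nodup_append.1 h.tab.nodup).2.1
      fun x hx => ⟨((h.mem x).1 hx).1, h.tab.valid x (List.mem_append_right _ hx)⟩
    simp at *
    omega

/-- Some state of counter `k` is final. -/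
def Graph.AcceptsAt (G : Graph) (k : ℕ) : Prop :=
  ∃ x : Item, x.lv = k ∧ G.Reaches x ∧ G.fin x.p = 1 ∧ G.fin x.q = 1

theorem wp_testAccept (h : AtLevel G k s L₀ L₁) :
    Wp testAccept s fun t s' => t ≤ G.levelSize * 30 + 10 ∧ AtLevel G k s' L₀ L₁ ∧
      (s'.reg .acc = 0 ↔ ¬ G.AcceptsAt k) := by
  classical
  unfold testAccept
  simp only [wp_seq, wp_set]
  set s₁ := (s.setReg .acc (Expr.eval s 0)).setReg .j
    (Expr.eval (s.setReg .acc (Expr.eval s 0)) Reg.lo) with hs₁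
  have ha₁ : Agree [.acc, .j] s s₁ := ((Agree.refl _ s).setReg (by decide)).setReg (by decide)
  have hlen : L₁.length ≤ G.levelSize :=
    G.length_le_levelSize (List.nodup_append.1 h.tab.nodup).2.1
      fun x hx => ⟨((h.mem x).1 hx).1, h.tab.valid x (List.mem_append_right _ hx)⟩
  have htab : ∀ {s'}, s'.reg .cnt = s.reg .cnt → s'.arr = s.arr → Tab G.n G.r s' (L₀ ++ L₁) :=
    fun h₁ h₂ => h.tab.congr h₁ fun a _ => by rw [h₂]
  have key : ∀ N i (s' : Store), L₁.length - i = N → i ≤ L₁.length → Agree [.acc, .j] s s' →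
      s'.arr = s.arr → s'.reg .j = L₀.length + i →
      Wp (.loop (.lt Reg.j Reg.cnt) (.j ≔ Reg.j + 1 ;;
        .ite (.and (.eq (.get .fin (.get .left Reg.j)) 1) (.eq (.get .fin (.get .right Reg.j)) 1))
          (.acc ≔ 1) .skip)) s' fun t s'' => t ≤ (L₁.length - i) * 30 + 5 ∧
        Agree [.acc, .j] s s'' ∧ s''.arr = s.arr ∧
        (s''.reg .acc = 0 ↔ s'.reg .acc = 0 ∧
          ∀ x ∈ L₁.drop i, ¬ (G.fin x.p = 1 ∧ G.fin x.q = 1)) := by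
    intro N
    induction N with
    | zero =>
      intro i s' hN hi ha harr hj
      refine Wp.loop_false ?_ ⟨by simp [Test.cost], ha, harr, ?_⟩
      · simp [Test.eval, hj, ha.reg .cnt (by decide), h.tab.cnt]
        omega
      · rw [List.drop_eq_nil_of_le (by omega)]
        simp
    | succ N ih =>
      intro i s' hN hi ha harr hj
      obtain ⟨x, hx⟩ : ∃ x, L₁[i]? = some x := ⟨_, List.getElem?_eq_getElem (by omega)⟩
      have hx' : (L₀ ++ L₁)[L₀.length + i]? = some x := by
        rw [List.getElem?_append_right (by omega), Nat.add_sub_cancel_left, hx]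
      obtain ⟨-, hl, hr⟩ := h.tab.row _ _ hx'
      refine Wp.loop_true ?_ ?_
      · simp [Test.eval, hj, ha.reg .cnt (by decide), h.tab.cnt]
        omega
      rw [wp_seq, wp_set]
      by_cases hf : G.fin x.p = 1 ∧ G.fin x.q = 1
      · rw [wp_ite_true, wp_set]
        · refine (ih (i + 1) _ (by omega) (by omega) ((ha.setReg (by simp)).setReg (by simp)) harr
            (by simp [hj, add_assoc])).mono ?_
          rintro t s'' ⟨ht, ha', harr', hacc⟩
          refine ⟨?_, ha', harr', hacc.trans ?_⟩
          · simp [Test.cost]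
            omega
          · simp only [mem_drop_iff hx]
            simp [hf]
        · simpa [Test.eval, hj, harr, hl, hr, h.loaded.fin] using hf
      · rw [wp_ite_false, wp_skip]
        · refine (ih (i + 1) _ (by omega) (by omega) (ha.setReg (by simp)) harr
            (by simp [hj, add_assoc])).mono ?_
          rintro t s'' ⟨ht, ha', harr', hacc⟩
          refine ⟨?_, ha', harr', hacc.trans ?_⟩
          · simp [Test.cost]
            omega
          · simp only [mem_drop_iff hx]
            simpa using fun _ _ => not_and.1 hf
        · simpa [Test.eval, hj, harr, hl, hr, h.loaded.fin] using hf
  refine (key _ 0 s₁ rfl (Nat.zero_le _) ha₁ rfl (by simp [hs₁, h.lo])).mono ?_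
  rintro t s₂ ⟨ht, ha₂, harr₂, hacc⟩
  refine ⟨?_, ⟨h.loaded.agree ha₂ (by decide) (by decide),
    htab (ha₂.reg _ (by decide)) harr₂, (ha₂.reg _ (by decide)).trans h.counter,
    (ha₂.reg _ (by decide)).trans h.lo, h.lt, h.mem⟩, hacc.trans ?_⟩
  · simp
    omega
  · simp only [hs₁, Store.reg_setReg, List.drop_zero, Graph.AcceptsAt, h.mem]
    simp

end Levels

/-! ### The preparation -/

section Prepare

/-- The number of transitions with numbers below `i` and source `p`. -/
def countSrc (src : ℕ → ℕ) (p i : ℕ) : ℕ := ((Finset.range i).filter (src · = p)).card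

/-- The number of transitions whose source is below `p`. -/
def firstPos (src : ℕ → ℕ) (m p : ℕ) : ℕ := ∑ q ∈ Finset.range p, countSrc src q m

theorem countSrc_succ (src : ℕ → ℕ) (p i : ℕ) :
    countSrc src p (i + 1) = countSrc src p i + if src i = p then 1 else 0 := by
  unfold countSrc
  rw [Finset.range_add_one, Finset.filter_insert]
  split_ifs
  · rw [Finset.card_insert_of_notMem (by simp)]
  · rfl

theorem firstPos_succ (src : ℕ → ℕ) (m p : ℕ) :
    firstPos src m (p + 1) = firstPos src m p + countSrc src p m := Finset.sum_range_succ _ _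

theorem firstPos_mono (src : ℕ → ℕ) (m : ℕ) : Monotone (firstPos src m) :=
  monotone_nat_of_le_succ fun p => by rw [firstPos_succ]; omega

/-- The transitions with source below `p` are partitioned by their sources. -/
theorem firstPos_le (src : ℕ → ℕ) (m p : ℕ) : firstPos src m p ≤ m := by
  calc firstPos src m p
      = ∑ q ∈ Finset.range p, (((Finset.range m).filter (src · < p)).filter (src · = q)).card := by
        refine Finset.sum_congr rfl fun q hq => congrArg Finset.card ?_
        rw [Finset.mem_range] at hq
        ext i
        simp
        rintro rfl -
        exact hq
    _ = ((Finset.range m).filter (src · < p)).card :=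
        (Finset.card_eq_sum_card_fiberwise (by intro i; simp)).symm
    _ ≤ m := (Finset.card_filter_le _ _).trans (Finset.card_range m).le

/-- The two stores differ only in what `prepare` changes. -/
structure Preparing (s s' : Store) : Prop where
  reg : ∀ x, x ∉ [Reg.p, .i, .i'] → s'.reg x = s.reg x
  arr : ∀ a, a ∉ [Arr.first, .aLab, .aDst] → s'.arr a = s.arr a

theorem Preparing.setReg {s s' : Store} {x : Reg} {v : ℕ} (h : Preparing s s')
    (hx : x ∈ [Reg.p, .i, .i']) : Preparing s (s'.setReg x v) := by
  refine ⟨fun y hy => ?_, h.arr⟩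
  have : y ≠ x := by rintro rfl; exact hy hx
  simp [this, h.reg y hy]

theorem Preparing.setArr {s s' : Store} {a : Arr} {i v : ℕ} (h : Preparing s s')
    (ha : a ∈ [Arr.first, .aLab, .aDst]) : Preparing s (s'.setArr a i v) := by
  refine ⟨h.reg, fun b hb => ?_⟩
  have : b ≠ a := by rintro rfl; exact hb ha
  simp [this, h.arr b hb]

variable {s : Store}

/-- The cells from `lo` to `hi` hold the transitions out of `p` with numbers below `i`. -/
def Holds (s s' : Store) (p lo hi i : ℕ) : Prop :=
  ∀ a b, (∃ l, lo ≤ l ∧ l < hi ∧ s'.arr .aLab l = a ∧ s'.arr .aDst l = b) ↔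
    ∃ l < i, s.arr .src l = p ∧ s.arr .lab l = a ∧ s.arr .dst l = b

theorem Holds.congr {s s₁ s₂ : Store} {p lo hi i : ℕ} (h : Holds s s₁ p lo hi i)
    (h₁ : ∀ l < hi, s₂.arr .aLab l = s₁.arr .aLab l ∧ s₂.arr .aDst l = s₁.arr .aDst l) :
    Holds s s₂ p lo hi i := by
  intro a b
  rw [← h a b]
  refine exists_congr fun l => and_congr_right fun _ => and_congr_right fun hl => ?_
  rw [(h₁ l hl).1, (h₁ l hl).2]

/-- The register `i'` is the next free cell. Cells below its initial value stay unchanged, which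
protects the blocks of earlier states. -/
theorem wp_prepare_inner {p m : ℕ} (hm : s.reg .nT = m) :
    ∀ (N i : ℕ) (s₁ : Store), m - i = N → i ≤ m → Preparing s s₁ → s₁.reg .p = p → s₁.reg .i = i →
      s₁.reg .i' = firstPos (s.arr .src) m p + countSrc (s.arr .src) p i →
      Holds s s₁ p (firstPos (s.arr .src) m p) (s₁.reg .i') i →
      Wp (.loop (.lt Reg.i Reg.nT) (
        .ite (.eq (.get .src Reg.i) Reg.p) (
          .put .aLab Reg.i' (.get .lab Reg.i) ;;
          .put .aDst Reg.i' (.get .dst Reg.i) ;;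
          .i' ≔ Reg.i' + 1) .skip ;;
        .i ≔ Reg.i + 1)) s₁ fun t s₂ => t ≤ (m - i) * 30 + 5 ∧ Preparing s s₂ ∧
          s₂.reg .p = p ∧ s₂.reg .i' = firstPos (s.arr .src) m (p + 1) ∧
          s₂.arr .first = s₁.arr .first ∧
          (∀ l < s₁.reg .i', s₂.arr .aLab l = s₁.arr .aLab l ∧ s₂.arr .aDst l = s₁.arr .aDst l) ∧
          Holds s s₂ p (firstPos (s.arr .src) m p) (firstPos (s.arr .src) m (p + 1)) m := by
  intro N
  induction N with
  | zero =>
    intro i s₁ hN hi hP hp hi₁ hi' hH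
    obtain rfl : i = m := by omega
    refine Wp.loop_false ?_ ⟨by simp [Test.cost], hP, hp, ?_, rfl, fun _ _ => ⟨rfl, rfl⟩, ?_⟩
    · simp [Test.eval, hi₁, hP.reg .nT (by decide), hm]
    · rw [hi', firstPos_succ]
    · rwa [firstPos_succ, ← hi']
  | succ N ih =>
    intro i s₁ hN hi hP hp hi₁ hi' hH
    refine Wp.loop_true ?_ ?_
    · simp [Test.eval, hi₁, hP.reg .nT (by decide), hm]
      omega
    rw [wp_seq]
    by_cases hs : s.arr .src i = p
    · rw [wp_ite_true]
      · simp only [wp_seq, wp_set, wp_put]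
        refine (ih (i + 1) _ (by omega) (by omega) ?_ (by simp [hp]) (by simp [hi₁]) ?_ ?_).mono ?_
        · exact ((((hP.setArr (by simp)).setArr (by simp)).setReg (by simp)).setReg (by simp))
        · simp [hi', countSrc_succ, hs, add_assoc]
        · intro a b
          have h := hH a b
          simp only [Store.reg_setReg, Store.arr_setReg, Expr.eval_hadd, Expr.eval_reg,
            Expr.eval_one, Expr.eval_get, Store.reg_setArr, Store.arr_setArr, reduceCtorEq,
            if_true, if_false, hi₁, hP.arr .lab (by decide), hP.arr .dst (by decide)]
          constructor
          · rintro ⟨l, h₁, h₂, h₃, h₄⟩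
            by_cases hl : l = s₁.reg .i'
            · subst hl
              rw [Function.update_self] at h₃ h₄
              exact ⟨i, Nat.lt_succ_self i, hs, h₃, h₄⟩
            · rw [Function.update_of_ne hl] at h₃ h₄
              obtain ⟨l', h₁', h'⟩ := h.1 ⟨l, h₁, by omega, h₃, h₄⟩
              exact ⟨l', by omega, h'⟩
          · rintro ⟨l, h₁, h₂, h₃, h₄⟩
            rcases Nat.eq_or_lt_of_le (Nat.le_of_lt_succ h₁) with rfl | h₁
            · refine ⟨s₁.reg .i', by omega, by omega, ?_, ?_⟩
              · rw [Function.update_self, h₃]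
              · rw [Function.update_self, h₄]
            · obtain ⟨l', h₁', h₂', h'⟩ := h.2 ⟨l, h₁, h₂, h₃, h₄⟩
              refine ⟨l', h₁', by omega, ?_⟩
              rwa [Function.update_of_ne (by omega), Function.update_of_ne (by omega)]
        · rintro t s₂ ⟨ht, hP₂, hp₂, hi₂, hf, hl, hH₂⟩
          refine ⟨?_, hP₂, hp₂, hi₂, ?_, ?_, hH₂⟩
          · simp [Test.cost]
            omega
          · rw [hf]
            simp
          · intro l hl'
            have := hl l (by simp; omega)
            simp only [Store.reg_setReg, Store.arr_setReg, Expr.eval_hadd, Expr.eval_reg,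
              Expr.eval_one, Expr.eval_get, Store.reg_setArr, Store.arr_setArr, reduceCtorEq,
              if_true, if_false] at this
            rwa [Function.update_of_ne (by omega), Function.update_of_ne (by omega)] at this
      · simp [Test.eval, hi₁, hp, hP.arr .src (by decide), hs]
    · rw [wp_ite_false]
      · rw [wp_skip, wp_set]
        refine (ih (i + 1) _ (by omega) (by omega) (hP.setReg (by simp)) (by simp [hp])
          (by simp [hi₁]) (by simp [hi', countSrc_succ, hs]) ?_).mono ?_
        · intro a b
          have h := hH a b
          simp only [Store.reg_setReg, Store.arr_setReg, reduceCtorEq, if_false]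
          rw [h]
          constructor
          · rintro ⟨l, h₁, h₂⟩
            exact ⟨l, by omega, h₂⟩
          · rintro ⟨l, h₁, h₂⟩
            refine ⟨l, ?_, h₂⟩
            have : l ≠ i := by rintro rfl; exact hs h₂.1
            omega
        · rintro t s₂ ⟨ht, hP₂, hp₂, hi₂, hf, hl, hH₂⟩
          refine ⟨?_, hP₂, hp₂, hi₂, hf, ?_, hH₂⟩
          · simp [Test.cost]
            omega
          · simpa using hl
      · simp [Test.eval, hi₁, hp, hP.arr .src (by decide), hs]

/-- Every state scans all transitions, which a bound quadratic in the size permits. The last write,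
to `first n`, ends the block of the last state; later entries stay `0`. -/
theorem wp_prepare {n m : ℕ} (hn : s.reg .nQ = n) (hm : s.reg .nT = m)
    (hf : ∀ p, s.arr .first p = 0) :
    Wp prepare s fun t s' => t ≤ n * (m * 30 + 30) + 15 ∧ Preparing s s' ∧
      (∀ p, s'.arr .first p = if p ≤ n then firstPos (s.arr .src) m p else 0) ∧
      ∀ p < n, Holds s s' p (s'.arr .first p) (s'.arr .first (p + 1)) m := by
  have key : ∀ (N p : ℕ) (s₁ : Store), n - p = N → p ≤ n → Preparing s s₁ → s₁.reg .p = p →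
      s₁.reg .i' = firstPos (s.arr .src) m p →
      (∀ q, s₁.arr .first q = if q < p then firstPos (s.arr .src) m q else 0) →
      (∀ q < p, Holds s s₁ q (firstPos (s.arr .src) m q) (firstPos (s.arr .src) m (q + 1)) m) →
      Wp (.loop (.lt Reg.p Reg.nQ) (
        .put .first Reg.p Reg.i' ;;
        .i ≔ 0 ;;
        .loop (.lt Reg.i Reg.nT) (
          .ite (.eq (.get .src Reg.i) Reg.p) (
            .put .aLab Reg.i' (.get .lab Reg.i) ;;
            .put .aDst Reg.i' (.get .dst Reg.i) ;;
            .i' ≔ Reg.i' + 1) .skip ;;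
          .i ≔ Reg.i + 1) ;;
        .p ≔ Reg.p + 1)) s₁ fun t s₂ => t ≤ (n - p) * (m * 30 + 30) + 5 ∧ Preparing s s₂ ∧
          s₂.reg .p = n ∧ s₂.reg .i' = firstPos (s.arr .src) m n ∧
          (∀ q, s₂.arr .first q = if q < n then firstPos (s.arr .src) m q else 0) ∧
          ∀ q < n, Holds s s₂ q (firstPos (s.arr .src) m q) (firstPos (s.arr .src) m (q + 1)) m := by
    intro N
    induction N with
    | zero =>
      intro p s₁ hN hp hP hp₁ hi' hF hH
      obtain rfl : p = n := by omega
      refine Wp.loop_false ?_ ⟨by simp [Test.cost], hP, hp₁, hi', hF, hH⟩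
      simp [Test.eval, hp₁, hP.reg .nQ (by decide), hn]
    | succ N ih =>
      intro p s₁ hN hp hP hp₁ hi' hF hH
      refine Wp.loop_true ?_ ?_
      · simp [Test.eval, hp₁, hP.reg .nQ (by decide), hn]
        omega
      rw [wp_seq, wp_put, wp_seq, wp_set, wp_seq]
      refine (wp_prepare_inner (p := p) hm _ 0 _ rfl (Nat.zero_le _)
        ((hP.setArr (by simp)).setReg (by simp)) (by simp [hp₁]) (by simp)
        (by simp [hi', countSrc]) ?_).mono ?_
      · intro a b
        simp [hi']
        intro l h₁ h₂
        omega
      · rintro t s₂ ⟨ht, hP₂, hp₂, hi₂, hf₂, hl₂, hH₂⟩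
        rw [wp_set]
        simp only [Store.reg_setReg, Store.reg_setArr, Store.arr_setReg, reduceCtorEq, if_false,
          Store.arr_setArr, if_true, Expr.eval_reg, hi', hp₁] at hf₂ hl₂
        refine (ih (p + 1) _ (by omega) (by omega) (hP₂.setReg (by simp)) (by simp [hp₂])
          (by simp [hi₂]) ?_ ?_).mono ?_
        · intro q
          simp only [Store.arr_setReg, hf₂]
          by_cases hq : q = p
          · subst hq
            simp
          · rw [Function.update_of_ne hq, hF]
            refine if_congr ?_ rfl rfl
            omega
        · intro q hq
          rcases Nat.eq_or_lt_of_le (Nat.le_of_lt_succ hq) with rfl | hq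
          · exact hH₂
          · refine (hH q hq).congr fun l hl => ?_
            exact hl₂ l (hl.trans_le (firstPos_mono _ _ hq))
        · rintro t' s₃ ⟨ht', h⟩
          refine ⟨?_, h⟩
          obtain ⟨d, hd⟩ : ∃ d, n - p = d + 1 := ⟨n - p - 1, by omega⟩
          rw [show n - (p + 1) = d by omega] at ht'
          rw [hd, Nat.add_mul]
          simp [Test.cost]
          omega
  unfold prepare
  rw [wp_seq, wp_set, wp_seq, wp_set, wp_seq]
  refine (key _ 0 _ rfl (Nat.zero_le _) ?_ (by simp) (by simp [firstPos]) ?_ ?_).mono ?_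
  · exact Preparing.setReg (Preparing.setReg ⟨fun _ _ => rfl, fun _ _ => rfl⟩ (by simp)) (by simp)
  · intro q
    simp [hf]
  · intro q hq
    omega
  · rintro t s₂ ⟨ht, hP, hp, hi', hF, hH⟩
    rw [wp_put]
    have hF' : ∀ p, (s₂.setArr .first (Expr.eval s₂ Reg.p) (Expr.eval s₂ Reg.i')).arr .first p =
        if p ≤ n then firstPos (s.arr .src) m p else 0 := by
      intro p
      by_cases hpn : p = n
      · subst hpn
        simp [hp, hi']
      · simp only [Store.arr_setArr_self, Expr.eval_reg, hp]
        rw [Function.update_of_ne hpn, hF]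
        refine if_congr ?_ rfl rfl
        omega
    refine ⟨?_, hP.setArr (by simp), hF', ?_⟩
    · rw [Nat.sub_zero] at ht
      simp
      omega
    · intro p hpn
      rw [hF', hF', if_pos hpn.le, if_pos (Nat.succ_le_of_lt hpn)]
      exact (hH p hpn).congr fun l _ => by simp

end Prepare

/-! ### The main loop -/

section Main

variable {G : Graph} {s : Store} {L₀ L₁ : List Item} {k d : ℕ}

/-- Testing level `k` alone suffices, since by `hmin` no smaller positive level accepts. The factor
1100 covers 1000 for `extend`, 40 for `testAccept`, and the loop test. -/
theorem wp_main_loop (hW : G.Wf) (hd : G.AcceptsAt d)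
    (hmin : ∀ k, 1 ≤ k → k < d → ¬ G.AcceptsAt k) :
    ∀ (N k : ℕ) (s : Store) (L₀ L₁ : List Item), d - k = N → 1 ≤ k → k ≤ d →
      AtLevel G k s L₀ L₁ → (s.reg .acc = 0 ↔ ¬ G.AcceptsAt k) →
      Wp (.loop (.eq Reg.acc 0) (extend ;; testAccept)) s fun t s' =>
        t ≤ (d - k) * (G.levelSize * 1100) + 5 ∧ s'.reg .k = d := by
  intro N
  induction N with
  | zero =>
    intro k s L₀ L₁ hN h1 hk h hacc
    obtain rfl : k = d := by omega
    refine Wp.loop_false ?_ ⟨by simp [Test.cost], h.counter⟩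
    exact decide_eq_false fun h0 => hacc.1 h0 hd
  | succ N ih =>
    intro k s L₀ L₁ hN h1 hk h hacc
    refine Wp.loop_true ?_ ?_
    · exact decide_eq_true (hacc.2 (hmin k h1 (by omega)))
    refine Wp.seq (wp_extend hW h) ?_
    rintro t s₁ ⟨ht, L₂, h₁⟩
    refine (wp_testAccept h₁).mono ?_
    rintro t' s₂ ⟨ht', h₂, hacc₂⟩
    refine (ih (k + 1) s₂ _ _ (by omega) (by omega) (by omega) h₂ hacc₂).mono ?_
    rintro t'' s₃ ⟨ht'', h₃⟩
    refine ⟨?_, h₃⟩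
    have := hW.one_le_levelSize
    obtain ⟨e, he⟩ : ∃ e, d - k = e + 1 := ⟨d - k - 1, by omega⟩
    rw [show d - (k + 1) = e by omega] at ht''
    rw [he, Nat.add_mul]
    simp [Test.cost]
    omega

/-- Levels `0` and `1` are built before the loop; since `d ≥ 1`, their cost is charged to one of `d`
rounds, whence 1600 instead of 1100. -/
theorem wp_main (hW : G.Wf) (hG : G.Loaded s) (hidx : ∀ i, s.arr .idx i = 0)
    (hinit : s.reg .init = G.start) (h1 : 1 ≤ d) (hd : G.AcceptsAt d)
    (hmin : ∀ k, 1 ≤ k → k < d → ¬ G.AcceptsAt k) :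
    Wp (.k ≔ 0 ;; .lo ≔ 0 ;; .cnt ≔ 0 ;; .ecnt ≔ 0 ;;
      addState Reg.k 0 Reg.init Reg.init ;; close ;; extend ;; testAccept ;;
      .loop (.eq Reg.acc 0) (extend ;; testAccept)) s fun t s' =>
        t ≤ d * (G.levelSize * 1600) ∧ s'.reg .k = d := by
  simp only [wp_seq (c := .set _ _), wp_set]
  set s₁ := (((s.setReg .k (Expr.eval s 0)).setReg .lo 0).setReg .cnt 0).setReg .ecnt 0 with hs₁
  change Wp _ s₁ _
  have hG₁ : G.Loaded s₁ := hG.agree (X := [.k, .lo, .cnt, .ecnt])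
    (((((Agree.refl _ _).setReg (by simp)).setReg (by simp)).setReg (by simp)).setReg (by simp))
    (by decide) (by decide)
  have hL₁ : Tab G.n G.r s₁ [] :=
    ⟨by simp [hs₁], List.nodup_nil, by simp, by simp [hs₁, hidx], by simp⟩
  have hinit₁ : s₁.reg .init = G.start := by simp [hs₁, hinit]
  refine Wp.seq (adds_addState (x := ⟨0, 0, G.start, G.start⟩) hG₁.n hG₁.r hL₁
    ⟨Nat.zero_le _, hW.start, hW.start⟩ ?_) ?_
  · intro s' ha
    simp [ha.reg .k (by decide), ha.reg .init (by decide), hinit₁]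
    simp [hs₁]
  rintro t s₂ ⟨ht, ha, L, hL, hE⟩
  have hm : ∀ y, y ∈ L ↔ y = ⟨0, 0, G.start, G.start⟩ := by simpa using hE.mem_iff
  refine Wp.seq (wp_close (k := 0) (L₀ := []) (L₁ := L) hW
    (hG₁.agree ha (by decide) (by decide)) hL ?_ ?_ (by simp) ?_ ?_) ?_
  · rw [ha.reg .k (by decide)]
    simp [hs₁]
  · rw [ha.reg .lo (by decide)]
    simp [hs₁]
  · intro x hx
    rw [hm] at hx
    subst hx
    exact ⟨rfl, .start⟩
  · rintro y hy (rfl | ⟨x, -, hxy⟩)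
    · exact (hm _).2 rfl
    · rw [hxy.lv] at hy
      omega
  rintro t₂ s₃ ⟨ht₂, L', h₃⟩
  refine Wp.seq (wp_extend hW h₃) ?_
  rintro t₃ s₄ ⟨ht₃, L'', h₄⟩
  refine Wp.seq (wp_testAccept h₄) ?_
  rintro t₄ s₅ ⟨ht₄, h₅, hacc⟩
  refine (wp_main_loop hW hd hmin _ 1 s₅ _ _ rfl le_rfl h1 h₅ hacc).mono ?_
  rintro t₅ s₆ ⟨ht₅, hk⟩
  refine ⟨?_, hk⟩
  have := hW.one_le_levelSize
  obtain ⟨e, rfl⟩ : ∃ e, d = e + 1 := ⟨d - 1, by omega⟩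
  rw [Nat.add_sub_cancel] at ht₅
  have : e * (G.levelSize * 1100) ≤ e * (G.levelSize * 1600) :=
    Nat.mul_le_mul_left _ (by omega)
  rw [Nat.add_mul]
  simp at *
  omega

end Main

/-! ### The automaton that `prepare` stores -/

section Final

variable {α Q : Type*} {M : NFA α Q} {s₀ : Q} {n m r : ℕ} {eQ : Q ≃ Fin n}
  {eT : transitions M ≃ Fin m} {eA : usedAlphabet M ≃ Fin r}

open Classical in
/-- The number of a symbol, and `0` for unused symbols. -/
noncomputable def symNum (eA : usedAlphabet M ≃ Fin r) (a : α) : ℕ :=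
  if h : a ∈ usedAlphabet M then eA ⟨a, h⟩ else 0

theorem symNum_injOn : Set.InjOn (symNum eA) (usedAlphabet M) := by
  intro a ha b hb h
  rw [symNum, symNum, dif_pos ha, dif_pos hb] at h
  exact congrArg Subtype.val (eA.injective (Fin.ext h))

theorem load_transition_iff {x y z : ℕ} :
    (∃ l < m, (load M s₀ eQ eT eA).arr .src l = x ∧ (load M s₀ eQ eT eA).arr .lab l = y ∧
      (load M s₀ eQ eT eA).arr .dst l = z) ↔
    ∃ t ∈ transitions M, (eQ t.1 : ℕ) = x ∧ symNum eA t.2.1 = y ∧ (eQ t.2.2 : ℕ) = z := by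
  have hsym : ∀ t (ht : t ∈ transitions M),
      symNum eA t.2.1 = eA ⟨t.2.1, t.1, t.2.2, ht⟩ := fun t ht => dif_pos ⟨t.1, t.2.2, ht⟩
  constructor
  · rintro ⟨l, hl, h₁, h₂, h₃⟩
    simp only [load, hl, dif_pos] at h₁ h₂ h₃
    exact ⟨_, (eT.symm ⟨l, hl⟩).2, h₁, (hsym _ (eT.symm ⟨l, hl⟩).2).trans h₂, h₃⟩
  · rintro ⟨t, ht, h₁, h₂, h₃⟩
    refine ⟨eT ⟨t, ht⟩, (eT ⟨t, ht⟩).2, ?_⟩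
    rw [hsym t ht] at h₂
    simpa [load] using ⟨h₁, h₂, h₃⟩

theorem load_fin_iff {p : Q} :
    (load M s₀ eQ eT eA).arr .fin (eQ p) = 1 ↔ p ∈ M.accept := by
  simp [load]

/-- The automaton in the store after the preparation. -/
def graphOf (n r start : ℕ) (s : Store) : Graph :=
  ⟨n, r, start, s.arr .first, s.arr .aLab, s.arr .aDst, s.arr .fin⟩

theorem graph_acceptsAt_iff {G : Graph} (hstart : G.start = eQ s₀)
    (hfin : G.fin = (load M s₀ eQ eT eA).arr .fin)
    (htr : ∀ x y z, G.tr x y z ↔ ∃ t ∈ transitions M,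
      (eQ t.1 : ℕ) = x ∧ symNum eA t.2.1 = y ∧ (eQ t.2.2 : ℕ) = z) (k : ℕ) :
    G.AcceptsAt k ↔ ∃ c p q, StateReach M s₀ k c p q ∧ p ∈ M.accept ∧ q ∈ M.accept := by
  constructor
  · rintro ⟨⟨i, d, x, y⟩, rfl, h, hx, hy⟩
    unfold Graph.Reaches at h
    rw [hstart] at h
    obtain ⟨c, p, q, rfl, rfl, rfl, hr⟩ := Reach.of_rename (f := fun q => (eQ q : ℕ))
      (Fin.val_injective.comp eQ.injective) symNum_injOn htr h
    rw [hfin] at hx hy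
    exact ⟨c, p, q, hr, load_fin_iff.1 hx, load_fin_iff.1 hy⟩
  · rintro ⟨c, p, q, hr, hp, hq⟩
    refine ⟨⟨k, tagNum (symNum eA) c, eQ p, eQ q⟩, rfl, ?_, ?_, ?_⟩
    · unfold Graph.Reaches
      rw [hstart]
      exact Reach.rename (f := fun q => (eQ q : ℕ)) symNum_injOn htr hr
    · rw [hfin]
      exact load_fin_iff.2 hp
    · rw [hfin]
      exact load_fin_iff.2 hq

/-- Each state contributes its out-degree plus one, so the sum is bounded by states plus
transitions. -/
theorem sum_deg_le {G : Graph} {src : ℕ → ℕ} {m : ℕ}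
    (h : ∀ p, G.first p = if p ≤ G.n then firstPos src m p else 0) :
    ∑ p ∈ Finset.range G.n, G.deg p ≤ G.n + m := by
  calc ∑ p ∈ Finset.range G.n, G.deg p
      = ∑ p ∈ Finset.range G.n, (countSrc src p m + 1) := by
        refine Finset.sum_congr rfl fun p hp => ?_
        rw [Finset.mem_range] at hp
        rw [Graph.deg, h, h, if_pos hp.le, if_pos (Nat.succ_le_of_lt hp), firstPos_succ,
          Nat.add_sub_cancel_left]
    _ = firstPos src m G.n + G.n := by
        rw [Finset.sum_add_distrib, Finset.sum_const, Finset.card_range, smul_eq_mul, mul_one,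
          firstPos]
    _ ≤ G.n + m := by
        have := firstPos_le src m G.n
        omega

/-- One of two different words is nonempty. This gives `r ≥ 1`, without which the time bound would
be `0`. -/
theorem exists_used (hL : ∃ u ∈ M.accepts, ∃ v ∈ M.accepts, u ≠ v) :
    (usedAlphabet M).Nonempty := by
  have key : ∀ a u, a :: u ∈ M.accepts → (usedAlphabet M).Nonempty := by
    intro a u h
    rw [NFA.mem_accepts, NFA.evalFrom_cons] at h
    obtain ⟨q, -, hq⟩ := h
    rw [NFA.mem_evalFrom_iff_exists] at hq
    obtain ⟨p', hp', -⟩ := hq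
    rw [NFA.mem_stepSet] at hp'
    obtain ⟨p, -, hp⟩ := hp'
    exact ⟨a, p, p', hp⟩
  obtain ⟨u, hu, v, hv, hne⟩ := hL
  rcases u with _ | ⟨a, u⟩
  · rcases v with _ | ⟨b, v⟩
    · exact absurd rfl hne
    · exact key b v hv
  · exact key a u hu

theorem wp_distBestInpAlter (hs : M.start = {s₀})
    (hL : ∃ u ∈ M.accepts, ∃ v ∈ M.accepts, u ≠ v) (eQ : Q ≃ Fin n)
    (eT : transitions M ≃ Fin m) (eA : usedAlphabet M ≃ Fin r) :
    Wp distBestInpAlter (load M s₀ eQ eT eA) fun t s =>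
      t ≤ 3300 * (n + m) ^ 2 * r ^ 2 * langDist M.accepts ∧ s.reg .k = langDist M.accepts := by
  have hd := isLeast_langDist hs hL
  set d := langDist M.accepts
  obtain ⟨i, c, p, q, hi, hid, hr, hp, hq⟩ := hd.1
  -- By minimality of `d` the accepting state lies on level `d` itself, not below.
  obtain rfl : i = d := le_antisymm hid (hd.2 ⟨i, c, p, q, hi, le_rfl, hr, hp, hq⟩)
  refine Wp.seq (wp_prepare (s := load M s₀ eQ eT eA) (n := n) (m := m) rfl rfl fun _ => rfl) ?_
  rintro t s₁ ⟨ht, hP, hF, hH⟩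
  set G := graphOf n r (eQ s₀) s₁
  have htr : ∀ x y z, G.tr x y z ↔ ∃ t ∈ transitions M,
      (eQ t.1 : ℕ) = x ∧ symNum eA t.2.1 = y ∧ (eQ t.2.2 : ℕ) = z := by
    intro x y z
    by_cases hx : x < n
    · exact (hH x hx y z).trans load_transition_iff
    -- For `x ≥ n` the entry `first (x + 1)` still has its initial value `0`, so no transition
    -- starts there.
    · constructor
      · rintro ⟨i, -, h, -⟩
        change i < s₁.arr .first (x + 1) at h
        rw [hF, if_neg (by omega)] at h
        exact absurd h (Nat.not_lt_zero _)
      · rintro ⟨t, -, rfl, -⟩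
        exact absurd (eQ t.1).2 hx
  have hW : G.Wf := by
    refine ⟨(eQ s₀).2, fun p hp i h₁ h₂ => ?_, fun p hp i h₁ h₂ => ?_⟩
    · obtain ⟨t, ht, -, h, -⟩ := (htr p (G.lab i) (G.dst i)).1 ⟨i, h₁, h₂, rfl, rfl⟩
      rw [← h, symNum, dif_pos ⟨_, _, ht⟩]
      exact Fin.is_lt _
    · obtain ⟨t, ht, -, -, h⟩ := (htr p (G.lab i) (G.dst i)).1 ⟨i, h₁, h₂, rfl, rfl⟩
      rw [← h]
      exact Fin.is_lt _
  have hG : G.Loaded s₁ := ⟨hP.reg .nQ (by decide), hP.reg .nS (by decide), rfl, rfl, rfl, rfl⟩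
  have hacc := graph_acceptsAt_iff (G := G) (s₀ := s₀) (eQ := eQ) (eT := eT) (eA := eA) rfl
    (hP.arr .fin (by decide)) htr
  refine (wp_main (d := d) hW hG (fun _ => by rw [hP.arr .idx (by decide)]; rfl)
    (hP.reg .init (by decide)) hi ((hacc d).2 ⟨c, p, q, hr, hp, hq⟩) ?_).mono ?_
  · intro k h1 hk h
    obtain ⟨c, p, q, h, hp, hq⟩ := (hacc k).1 h
    exact absurd (hd.2 ⟨k, c, p, q, h1, le_rfl, h, hp, hq⟩) (not_le.2 hk)
  · rintro t' s₂ ⟨ht', hk⟩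
    refine ⟨?_, hk⟩
    obtain ⟨a, ha⟩ := exists_used hL
    have hr1 : 1 ≤ r := Fin.pos (eA ⟨a, ha⟩)
    have hn1 : 1 ≤ n := Fin.pos (eQ s₀)
    have hS : ∑ p ∈ Finset.range G.n, G.deg p ≤ n + m := sum_deg_le (G := G) hF
    -- The only place where the bound becomes quadratic in `r`: `r + 1 ≤ 2 * r ^ 2` for `r ≥ 1`.
    have hlev : G.levelSize ≤ 2 * r ^ 2 * (n + m) ^ 2 := by
      refine Nat.mul_le_mul ?_ (Nat.pow_le_pow_left hS 2)
      change r + 1 ≤ _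
      nlinarith
    have hprep : n * (m * 30 + 30) + 15 ≤ 100 * (n + m) ^ 2 := by nlinarith
    have hone : 1 ≤ r ^ 2 * d := Nat.mul_pos (Nat.pow_pos hr1) hi
    -- The preparation is independent of `r` and `d`, and is multiplied by `r ^ 2 * d ≥ 1`; then
    -- 3300 is `100 + 2 * 1600`.
    calc t + t' ≤ 100 * (n + m) ^ 2 * (r ^ 2 * d) + d * (2 * r ^ 2 * (n + m) ^ 2 * 1600) :=
          Nat.add_le_add ((ht.trans hprep).trans (Nat.le_mul_of_pos_right _ hone))
            (ht'.trans (Nat.mul_le_mul_left _ (Nat.mul_le_mul_right _ hlev)))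
      _ = 3300 * (n + m) ^ 2 * r ^ 2 * d := by ring

end Final

end EditDist

theorem mainTheorem2 :
    ∃ C : ℕ, ∀ (α : Type*) (Q : Type*) (M : NFA α Q) (s₀ : Q), M.start = {s₀} →
      (∃ u ∈ M.accepts, ∃ v ∈ M.accepts, u ≠ v) →
      ∀ (n m r : ℕ) (eQ : Q ≃ Fin n) (eT : EditDist.transitions M ≃ Fin m)
        (eA : EditDist.usedAlphabet M ≃ Fin r),
      ∃ (t : ℕ) (s : EditDist.Store),
        EditDist.Run EditDist.distBestInpAlter (EditDist.load M s₀ eQ eT eA) t s ∧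
        s.reg .k = EditDist.langDist M.accepts ∧
        IsLeast {k | 1 ≤ k ∧ EditDist.HasAcceptingPath (EditDist.product (EditDist.T α k) M)}
          (s.reg .k) ∧
        t ≤ C * EditDist.size M ^ 2 * r ^ 2 * EditDist.langDist M.accepts := by
  refine ⟨3300, fun α Q M s₀ hs hL n m r eQ eT eA => ?_⟩
  obtain ⟨t, s, hrun, ht, hk⟩ := EditDist.wp_distBestInpAlter hs hL eQ eT eA
  have hd := EditDist.isLeast_langDist hs hL
  refine ⟨t, s, hrun, hk, ?_, ?_⟩
  · simp only [EditDist.hasAcceptingPath_iff hs, hk]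
    refine ⟨⟨?_, hd.1⟩, fun k h => hd.2 h.2⟩
    obtain ⟨i, c, p, q, hi, hid, -⟩ := hd.1
    exact hi.trans hid
  · rwa [EditDist.size, Nat.card_congr eQ, Nat.card_congr eT, Nat.card_fin, Nat.card_fin]
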